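/- Let $A$ be an Artinian local ring with algebraically closed residue field $k$. Let $p$ be a prime and $m\ge 0$ such that either $\operatorname{char}A=p^{m+1}$, or $\operatorname{char}A=0$ and $m=0$ (in the latter case $p$ is arbitrary). Write $W_m$ for the functor of $p$-typical Witt vectors with $m+1$ components (so $W_0(R)=R$), and regard $A$ as a $W_m(k)$-algebra through a ring homomorphism $W_m(k)\to A$ which lifts the projection $W_m(k)\to k$ to the first component (if $\operatorname{char}A=p^{m+1}$ there is exactly one such homomorphism; if $\operatorname{char}A=0$ it is the choice of a coefficient field). Let $\mathbf A$ be Greenberg's ring scheme attached to $A$: for every $k$-algebra $R$, $$\mathbf A(R)=\bigl(A\otimes_{W_m(k)}W_m(R)\bigr)\big/N(R),$$ where $N(R)$ is the ideal generated by all $a\otimes w$ such that for some $n\ge 0$ one has $p^na=0$ and the first $n$ components of $w$ vanish. (This is the fpqc sheaf associated with $R\mapsto A\otimes_{W_m(k)}W_m(R)$; moreover $N(R)=0$ if $m=0$, or if $\operatorname{char}A=p^{m+1}$ and $A$ is flat over $W_m(k)$, or if $\operatorname{char}k=p$ and $R$ is perfect.) The Greenberg functor $\mathcal F$ sends a functor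 $\mathbf X$ from $A$-algebras to sets (or groups) to the functor $(\mathcal F\mathbf X)(R)=\mathbf X(\mathbf A(R))$ on $k$-algebras. For a group functor $\mathbf G$ over a ring $R_0$, the identity component $\mathbf G^0$ is defined by $$\mathbf G^0(S)=\{g\in\mathbf G(S)\mid g_s\in(\mathbf G_{\kappa(s)})^0(\kappa(s))\text{ for all }s\in\operatorname{Spec}S\}$$ for every $R_0$-algebra $S$, where $\kappa(s)$ is the residue field at $s$, $g_s$ is the image of $g$ in $\mathbf G(\kappa(s))$, $\mathbf G_{\kappa(s)}$ is the base extension of $\mathbf G$ to $\kappa(s)$, which is required to be an affine group scheme, and $(\mathbf G_{\kappa(s)})^0$ is the connected component of the identity of this group scheme over a field. Let $\mathbf G$ be an affine smooth group scheme over $A$. Then $$\mathcal F(\mathbf G^0)=(\mathcal F\mathbf G)^0$$ as subfunctors of $\mathcal F\mathbf G$; that is, $\mathbf G^0(\mathbf A(R))=(\mathcal F\mathbf G)^0(R)$ inside $\mathbf G(\mathbf A(R))=(\mathcal F\mathbf G)(R)$ for every $k$-algebra $R$. -/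

import Mathlib

open CategoryTheory TensorProduct

universe u

/-! ### Truncated Witt vectors as a functor -/

namespace TruncatedWittVector

variable (p n : ℕ) [Fact p.Prime]

/-- Functoriality of truncated Witt vectors: apply a ring homomorphism to every component. -/
noncomputable def map {R S : Type u} [CommRing R] [CommRing S] (f : R →+* S) :
    TruncatedWittVector p n R →+* TruncatedWittVector p n S :=
  RingHom.liftOfSurjective (WittVector.truncate n : WittVector p R →+* _)
    (WittVector.truncate_surjective p n R)
    ⟨(WittVector.truncate n).comp (WittVector.map f), by
      intro x hx
      rw [WittVector.mem_ker_truncate] at hx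
      rw [RingHom.mem_ker, RingHom.comp_apply, ← RingHom.mem_ker, WittVector.mem_ker_truncate]
      intro i hi
      rw [WittVector.map_coeff, hx i hi, map_zero]⟩

theorem map_truncate {R S : Type u} [CommRing R] [CommRing S] (f : R →+* S)
    (x : WittVector p R) :
    map p n f (WittVector.truncate n x) = WittVector.truncate n (WittVector.map f x) :=
  RingHom.liftOfRightInverse_comp_apply _ _ _ _ x

@[simp]
theorem coeff_map {R S : Type u} [CommRing R] [CommRing S] (f : R →+* S)
    (x : TruncatedWittVector p n R) (i : Fin n) : (map p n f x).coeff i = f (x.coeff i) := by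
  obtain ⟨x, rfl⟩ := WittVector.truncate_surjective p n R x
  rw [map_truncate, WittVector.coeff_truncate, WittVector.coeff_truncate, WittVector.map_coeff]

theorem map_id {R : Type u} [CommRing R] (x : TruncatedWittVector p n R) :
    map p n (RingHom.id R) x = x := by
  ext i; simp

theorem map_map {R S T : Type u} [CommRing R] [CommRing S] [CommRing T] (f : R →+* S)
    (g : S →+* T) (x : TruncatedWittVector p n R) :
    map p n g (map p n f x) = map p n (g.comp f) x := by
  ext i; simp

end TruncatedWittVector

/-! ### The canonical structure of algebra over the truncated Witt vectors -/

/-- A local ring `A` with residue field `k`, equipped with a structure of algebra over the ring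
`W_m(k)` of Witt vectors with `m + 1` components, is a *Witt algebra* if the structure map
`W_m(k) → A` lifts the projection `W_m(k) → k` to the first component. -/
class IsWittAlgebra (p m : ℕ) [Fact p.Prime] (A : Type u) [CommRing A] [IsLocalRing A]
    [Algebra (TruncatedWittVector p (m + 1) (IsLocalRing.ResidueField A)) A] : Prop where
  residue_algebraMap : ∀ x : TruncatedWittVector p (m + 1) (IsLocalRing.ResidueField A),
    IsLocalRing.residue A (algebraMap _ A x) = x.coeff 0

namespace IsWittAlgebra

variable (p m : ℕ) [Fact p.Prime] (A : Type u) [CommRing A] [IsLocalRing A] [IsArtinianRing A]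

theorem isNilpotent_maximalIdeal : IsNilpotent (IsLocalRing.maximalIdeal A) := by
  rw [← IsLocalRing.jacobson_eq_maximalIdeal ⊥ bot_ne_top]
  exact IsArtinianRing.isNilpotent_jacobson_bot

theorem natCast_mem_maximalIdeal (p m : ℕ) (A : Type u) [CommRing A] [IsLocalRing A]
    [CharP A (p ^ (m + 1))] : (p : A) ∈ IsLocalRing.maximalIdeal A := by
  refine (IsLocalRing.maximalIdeal.isMaximal A).isPrime.mem_of_pow_mem (m + 1) ?_
  have := CharP.cast_eq_zero A (p ^ (m + 1))
  push_cast at this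
  rw [this]
  exact zero_mem _

theorem charP_residueField (p m : ℕ) [Fact p.Prime] (A : Type u) [CommRing A] [IsLocalRing A]
    [CharP A (p ^ (m + 1))] : CharP (IsLocalRing.ResidueField A) p := by
  refine (CharP.charP_iff_prime_eq_zero Fact.out).2 ?_
  have := (IsLocalRing.residue_eq_zero_iff (p : A)).2 (natCast_mem_maximalIdeal p m A)
  rwa [map_natCast] at this

/-- In characteristic `p ^ (m + 1)` a local Artinian ring with perfect residue field has a
structure of Witt algebra. -/
theorem exists_of_charP [CharP A (p ^ (m + 1))] [PerfectField (IsLocalRing.ResidueField A)] :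
    ∃ φ : TruncatedWittVector p (m + 1) (IsLocalRing.ResidueField A) →+* A,
      ∀ x, IsLocalRing.residue A (φ x) = x.coeff 0 := by
  have : CharP (IsLocalRing.ResidueField A) p := charP_residueField p m A
  have : ExpChar (IsLocalRing.ResidueField A) p := ExpChar.prime Fact.out
  have : PerfectRing (IsLocalRing.ResidueField A) p := PerfectField.toPerfectRing p
  have hp := Fact.out (p := p.Prime)
  obtain ⟨M, hM⟩ := isNilpotent_maximalIdeal A
  have hchar : (p : A) ^ (m + 1) = 0 := by
    have := CharP.cast_eq_zero A (p ^ (m + 1))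
    push_cast at this
    exact this
  have hghost : ∀ x : WittVector p A, WittVector.ghostComponent (M + m) x =
      ∑ i ∈ Finset.range (M + m + 1), (p : A) ^ i * x.coeff i ^ p ^ (M + m - i) := by
    intro x
    rw [WittVector.ghostComponent_apply, aeval_wittPolynomial]
  have hvanish : ∀ x : WittVector p A,
      (∀ i < m + 1, x.coeff i ∈ IsLocalRing.maximalIdeal A) →
        WittVector.ghostComponent (M + m) x = 0 := by
    intro x hx
    rw [hghost]
    refine Finset.sum_eq_zero fun i _ => ?_
    by_cases hi : i < m + 1
    · have h1 : M ≤ p ^ (M + m - i) :=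
        le_trans (by omega : M ≤ M + m - i) (Nat.lt_pow_self hp.one_lt).le
      have h2 : x.coeff i ^ p ^ (M + m - i) = 0 := by
        have := Ideal.pow_le_pow_right h1 (Ideal.pow_mem_pow (hx i hi) (p ^ (M + m - i)))
        rw [hM] at this
        exact this
      rw [h2, mul_zero]
    · rw [← Nat.sub_add_cancel (not_lt.1 hi), pow_add, hchar, mul_zero, zero_mul]
  -- the map `W(k) → A` induced by the ghost component
  have hsurj : Function.Surjective (WittVector.map (p := p) (IsLocalRing.residue A)) :=
    WittVector.map_surjective _ IsLocalRing.residue_surjective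
  let g : WittVector p (IsLocalRing.ResidueField A) →+* A :=
    RingHom.liftOfSurjective (WittVector.map (p := p) (IsLocalRing.residue A)) hsurj
      ⟨WittVector.ghostComponent (M + m), fun x hx => by
        rw [RingHom.mem_ker] at hx ⊢
        refine hvanish x fun i _ => ?_
        rw [← IsLocalRing.residue_eq_zero_iff, ← WittVector.map_coeff, hx, WittVector.zero_coeff]⟩
  have hg : ∀ x, g (WittVector.map (IsLocalRing.residue A) x) =
      WittVector.ghostComponent (M + m) x := fun x =>
    RingHom.liftOfRightInverse_comp_apply _ _ _ _ x
  let ψ := WittVector.map (p := p)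
    (iterateFrobeniusEquiv (IsLocalRing.ResidueField A) p (M + m)).symm.toRingHom
  have hker : RingHom.ker (WittVector.truncate (m + 1) :
      WittVector p (IsLocalRing.ResidueField A) →+* _) ≤ RingHom.ker (g.comp ψ) := by
    intro x hx
    rw [WittVector.mem_ker_truncate] at hx
    obtain ⟨y, hy⟩ := hsurj (ψ x)
    rw [RingHom.mem_ker, RingHom.comp_apply, ← hy, hg]
    refine hvanish y fun i hi => ?_
    rw [← IsLocalRing.residue_eq_zero_iff, ← WittVector.map_coeff, hy, WittVector.map_coeff,
      hx i hi, map_zero]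
  refine ⟨RingHom.liftOfSurjective _ (WittVector.truncate_surjective p (m + 1) _)
    ⟨g.comp ψ, hker⟩, fun x => ?_⟩
  obtain ⟨x, rfl⟩ := WittVector.truncate_surjective p (m + 1) _ x
  have h1 := RingHom.liftOfRightInverse_comp_apply _ _
    (Function.rightInverse_surjInv (WittVector.truncate_surjective p (m + 1) _))
    ⟨g.comp ψ, hker⟩ x
  refine (congrArg (IsLocalRing.residue A) h1).trans ?_
  obtain ⟨y, hy⟩ := hsurj (ψ x)
  rw [RingHom.comp_apply, ← hy, hg, hghost, map_sum, Finset.sum_eq_single 0]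
  · rw [pow_zero, one_mul, map_pow, ← WittVector.map_coeff, hy, WittVector.map_coeff, Nat.sub_zero]
    have := (iterateFrobeniusEquiv (IsLocalRing.ResidueField A) p (M + m)).apply_symm_apply
      (x.coeff 0)
    rw [iterateFrobeniusEquiv_def] at this
    exact this
  · intro i _ hi
    rw [map_mul, map_pow, map_natCast, CharP.cast_eq_zero, zero_pow hi, zero_mul]
  · simp

/-- In characteristic `p ^ (m + 1)` the structure of Witt algebra is unique. -/
theorem unique_of_charP [CharP A (p ^ (m + 1))] [PerfectField (IsLocalRing.ResidueField A)]
    (φ ψ : TruncatedWittVector p (m + 1) (IsLocalRing.ResidueField A) →+* A)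
    (hφ : ∀ x, IsLocalRing.residue A (φ x) = x.coeff 0)
    (hψ : ∀ x, IsLocalRing.residue A (ψ x) = x.coeff 0) : φ = ψ := by
  have : CharP (IsLocalRing.ResidueField A) p := charP_residueField p m A
  have : ExpChar (IsLocalRing.ResidueField A) p := ExpChar.prime Fact.out
  have : PerfectRing (IsLocalRing.ResidueField A) p := PerfectField.toPerfectRing p
  have hp := Fact.out (p := p.Prime)
  obtain ⟨M, hM⟩ := isNilpotent_maximalIdeal A
  have hpow : ∀ (n : ℕ) (a b : A), a - b ∈ IsLocalRing.maximalIdeal A →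
      a ^ p ^ n - b ^ p ^ n ∈ IsLocalRing.maximalIdeal A ^ (n + 1) := by
    intro n
    induction n with
    | zero => intro a b h; simpa using h
    | succ n ih =>
      intro a b h
      have h0 := ih a b h
      rw [pow_succ p, pow_mul, pow_mul, ← Commute.geom_sum₂_mul (Commute.all _ _), pow_succ,
        mul_comm (_ ^ (n + 1)) _]
      refine Ideal.mul_mem_mul ?_ h0
      rw [← IsLocalRing.residue_eq_zero_iff, map_sum]
      have h2 : IsLocalRing.residue A (a ^ p ^ n) = IsLocalRing.residue A (b ^ p ^ n) := by
        rw [← sub_eq_zero, ← map_sub, IsLocalRing.residue_eq_zero_iff]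
        exact Ideal.pow_le_self (Nat.succ_ne_zero n) h0
      have h3 : ∀ i ∈ Finset.range p, IsLocalRing.residue A
          ((a ^ p ^ n) ^ i * (b ^ p ^ n) ^ (p - 1 - i)) =
            IsLocalRing.residue A (b ^ p ^ n) ^ (p - 1) := by
        intro i hi
        rw [Finset.mem_range] at hi
        rw [map_mul, map_pow _ _ i, map_pow _ _ (p - 1 - i), h2, ← pow_add]
        congr 1
        omega
      rw [Finset.sum_congr rfl h3, Finset.sum_const, Finset.card_range, nsmul_eq_mul,
        CharP.cast_eq_zero, zero_mul]
  have key : φ.comp (WittVector.truncate (m + 1)) = ψ.comp (WittVector.truncate (m + 1)) := by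
    refine WittVector.eq_of_apply_teichmuller_eq (p := p) _ _
      ⟨m + 1, ?_⟩ fun x => ?_
    · have := CharP.cast_eq_zero A (p ^ (m + 1))
      push_cast at this
      exact this
    · obtain ⟨y, rfl⟩ := (iterateFrobeniusEquiv (IsLocalRing.ResidueField A) p M).surjective x
      rw [iterateFrobeniusEquiv_def, map_pow, map_pow, map_pow, ← sub_eq_zero]
      have h := hpow M (φ.comp (WittVector.truncate (m + 1)) (WittVector.teichmuller p y))
        (ψ.comp (WittVector.truncate (m + 1)) (WittVector.teichmuller p y)) (by
          rw [← IsLocalRing.residue_eq_zero_iff, map_sub, RingHom.comp_apply, RingHom.comp_apply,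
            hφ, hψ, sub_self])
      have := Ideal.pow_le_pow_right (Nat.le_succ M) h
      rw [hM] at this
      exact this
  ext x
  obtain ⟨x, rfl⟩ := WittVector.truncate_surjective p (m + 1) _ x
  exact RingHom.congr_fun key x

/-- In characteristic `0` (where `m = 0` and `W_m(k) = k`) a local Artinian ring has a structure
of Witt algebra, that is, a coefficient field. -/
theorem exists_of_charZero [CharP A 0] :
    ∃ φ : TruncatedWittVector p (0 + 1) (IsLocalRing.ResidueField A) →+* A,
      ∀ x, IsLocalRing.residue A (φ x) = x.coeff 0 := by
  obtain ⟨M, hM⟩ := isNilpotent_maximalIdeal A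
  have : CharZero A := CharP.charP_to_charZero A
  have hunit : ∀ n : ℕ, n ≠ 0 → IsUnit (n : A) := by
    intro n hn
    by_contra h
    have h1 := Ideal.pow_mem_pow ((IsLocalRing.mem_maximalIdeal (n : A)).2 h) M
    rw [hM] at h1
    have h2 : ((n ^ M : ℕ) : A) = 0 := by push_cast; exact h1
    exact hn (eq_zero_of_pow_eq_zero (Nat.cast_eq_zero.1 h2))
  have : CharZero (IsLocalRing.ResidueField A) := by
    refine charZero_of_inj_zero fun n hn => ?_
    by_contra h
    exact (((hunit n h).map (IsLocalRing.residue A)).ne_zero) (by rw [map_natCast]; exact hn)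
  let : Algebra ℚ A := (IsLocalization.lift (M := nonZeroDivisors ℤ) (S := ℚ)
    (g := Int.castRingHom A) (fun y => by
      have h1 := hunit (y : ℤ).natAbs (by simp)
      rcases Int.natAbs_eq (y : ℤ) with h | h
      · rw [h, eq_intCast, Int.cast_natCast]
        exact h1
      · rw [h, eq_intCast, Int.cast_neg, Int.cast_natCast]
        exact h1.neg)).toAlgebra
  obtain ⟨s, hs⟩ := exists_isTranscendenceBasis ℚ (IsLocalRing.ResidueField A)
  have := hs.isAlgebraic_field
  have : Algebra.FormallySmooth ℚ (IsLocalRing.ResidueField A) :=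
    Algebra.FormallySmooth.of_algebraicIndependent_of_isSeparable hs.1
  let g : A →ₐ[ℚ] IsLocalRing.ResidueField A :=
    { IsLocalRing.residue A with commutes' := fun q => RingHom.congr_fun (Subsingleton.elim
        ((IsLocalRing.residue A).comp (algebraMap ℚ A)) (algebraMap ℚ _)) q }
  have hker : IsNilpotent (RingHom.ker (g : A →+* IsLocalRing.ResidueField A)) :=
    ⟨M, by
      have : RingHom.ker (g : A →+* IsLocalRing.ResidueField A) = IsLocalRing.maximalIdeal A :=
        IsLocalRing.ker_residue
      rw [this, hM]⟩
  let σ : IsLocalRing.ResidueField A →ₐ[ℚ] A := Algebra.FormallySmooth.liftOfSurjective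
    (AlgHom.id ℚ _) g IsLocalRing.residue_surjective hker
  have hσ : ∀ x, IsLocalRing.residue A (σ x) = x := fun x =>
    Algebra.FormallySmooth.liftOfSurjective_apply (AlgHom.id ℚ _) g
      IsLocalRing.residue_surjective hker x
  let c : TruncatedWittVector p (0 + 1) (IsLocalRing.ResidueField A) →+*
      IsLocalRing.ResidueField A :=
    RingHom.liftOfSurjective (WittVector.truncate (0 + 1))
      (WittVector.truncate_surjective p (0 + 1) _)
      ⟨WittVector.constantCoeff, fun x hx => (WittVector.mem_ker_truncate _ x).1 hx 0 one_pos⟩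
  refine ⟨(σ : _ →+* A).comp c, fun x => ?_⟩
  obtain ⟨x, rfl⟩ := WittVector.truncate_surjective p (0 + 1) _ x
  refine (hσ _).trans ?_
  exact RingHom.liftOfRightInverse_comp_apply _ _ _ _ x

end IsWittAlgebra

/-! ### The ring scheme attached to `A` -/

namespace GreenbergRing

variable (p m : ℕ) [Fact p.Prime]

/-- For a `k`-algebra `R`, the ring `W_m(R)` is an algebra over `W_m(k)` by functoriality. -/
@[reducible] noncomputable def wittAlgebra (k R : Type u) [CommRing k] [CommRing R] [Algebra k R] :
    Algebra (TruncatedWittVector p (m + 1) k) (TruncatedWittVector p (m + 1) R) :=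
  (TruncatedWittVector.map p (m + 1) (algebraMap k R)).toAlgebra

section

attribute [local instance] wittAlgebra

/-- `W_m` as a functor from `k`-algebras to `W_m(k)`-algebras. -/
noncomputable def wittMap (k : Type u) [CommRing k] {R S : Type u} [CommRing R] [CommRing S]
    [Algebra k R] [Algebra k S] (f : R →ₐ[k] S) :
    TruncatedWittVector p (m + 1) R →ₐ[TruncatedWittVector p (m + 1) k]
      TruncatedWittVector p (m + 1) S :=
  { TruncatedWittVector.map p (m + 1) (f : R →+* S) with
    commutes' := fun x => by
      change TruncatedWittVector.map p (m + 1) (f : R →+* S)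
        (TruncatedWittVector.map p (m + 1) (algebraMap k R) x) =
          TruncatedWittVector.map p (m + 1) (algebraMap k S) x
      rw [TruncatedWittVector.map_map, AlgHom.comp_algebraMap] }

variable (A : Type u) [CommRing A] [IsLocalRing A]
  [Algebra (TruncatedWittVector p (m + 1) (IsLocalRing.ResidueField A)) A]

/-- The `A`-algebra `A ⊗_{W_m(k)} W_m(R)`, for an algebra `R` over the residue field `k`. -/
noncomputable abbrev Pre (R : Type u) [CommRing R] [Algebra (IsLocalRing.ResidueField A) R] : Type u :=
  A ⊗[TruncatedWittVector p (m + 1) (IsLocalRing.ResidueField A)] TruncatedWittVector p (m + 1) R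

/-- The ideal of `A ⊗_{W_m(k)} W_m(R)` generated by the elements `a ⊗ w` where `p ^ n * a = 0` and
the first `n` components of `w` vanish (that is, `w` is an `n`-fold Verschiebung). -/
noncomputable def relations (R : Type u) [CommRing R] [Algebra (IsLocalRing.ResidueField A) R] :
    Ideal (Pre p m A R) :=
  Ideal.span {z | ∃ (n : ℕ) (a : A) (w : TruncatedWittVector p (m + 1) R),
    (p : A) ^ n * a = 0 ∧ (∀ i : Fin (m + 1), (i : ℕ) < n → w.coeff i = 0) ∧ z = a ⊗ₜ w}

/-- The value `𝐀(R)` at `R` of Greenberg's ring scheme attached to `A`.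

The quotient by `relations` replaces `W_m(R) / p ^ n`, which is not a sheaf in `R` for `0 < n ≤ m`,
by `W_m(R) / V ^ n`, the ring of Witt vectors of length `n`: a decomposition
`A ≅ ⨁ W_m(k) / p ^ (n i)` of `W_m(k)`-modules makes `𝐀(R)` the product of the groups of Witt
vectors of `R` of length `n i`, so that `𝐀` is represented by an affine space. It is the fpqc sheaf
associated with `R ↦ A ⊗_{W_m(k)} W_m(R)`, and it is equal to this functor if `m = 0`, or if `A` is
flat over `W_m(k)`, and for every `A` on perfect algebras `R`; see
`relations_eq_bot_of_eq_zero`, `relations_eq_bot_of_flat`, `relations_eq_bot_of_perfectRing`. -/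
noncomputable abbrev Points (R : Type u) [CommRing R] [Algebra (IsLocalRing.ResidueField A) R] : Type u :=
  Pre p m A R ⧸ relations p m A R

variable {A} {R S T : Type u} [CommRing R] [CommRing S] [CommRing T]
  [Algebra (IsLocalRing.ResidueField A) R] [Algebra (IsLocalRing.ResidueField A) S]
  [Algebra (IsLocalRing.ResidueField A) T]

/-- The map `A ⊗ W_m(R) → A ⊗ W_m(S)` induced by `R → S`. -/
noncomputable def preMap (f : R →ₐ[IsLocalRing.ResidueField A] S) :
    Pre p m A R →ₐ[A] Pre p m A S :=
  Algebra.TensorProduct.map (AlgHom.id A A) (wittMap p m (IsLocalRing.ResidueField A) f)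

theorem relations_le_comap (f : R →ₐ[IsLocalRing.ResidueField A] S) :
    relations p m A R ≤ (relations p m A S).comap (preMap p m f) := by
  refine Ideal.span_le.2 ?_
  rintro _ ⟨n, a, w, ha, hw, rfl⟩
  refine Ideal.subset_span ⟨n, a, wittMap p m _ f w, ha, fun i hi => ?_, rfl⟩
  change (TruncatedWittVector.map p (m + 1) (f : R →+* S) w).coeff i = 0
  rw [TruncatedWittVector.coeff_map, hw i hi, map_zero]

/-- Functoriality in `R` of Greenberg's ring scheme. -/
noncomputable def pointsMap (f : R →ₐ[IsLocalRing.ResidueField A] S) :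
    Points p m A R →ₐ[A] Points p m A S :=
  Ideal.quotientMapₐ (relations p m A S) (preMap p m f) (relations_le_comap p m f)

theorem preMap_id (x : Pre p m A R) :
    preMap p m (AlgHom.id (IsLocalRing.ResidueField A) R) x = x := by
  induction x using TensorProduct.induction_on with
  | zero => simp
  | add x y hx hy => rw [map_add, hx, hy]
  | tmul a w => exact congrArg (a ⊗ₜ ·) (TruncatedWittVector.map_id p (m + 1) w)

theorem preMap_comp (f : R →ₐ[IsLocalRing.ResidueField A] S)
    (g : S →ₐ[IsLocalRing.ResidueField A] T) (x : Pre p m A R) :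
    preMap p m (g.comp f) x = preMap p m g (preMap p m f x) := by
  induction x using TensorProduct.induction_on with
  | zero => simp
  | add x y hx hy => rw [map_add, hx, hy, map_add, map_add]
  | tmul a w =>
    exact congrArg (a ⊗ₜ ·) (TruncatedWittVector.map_map p (m + 1) (f : R →+* S) (g : S →+* T) w).symm

theorem pointsMap_id (x : Points p m A R) :
    pointsMap p m (AlgHom.id (IsLocalRing.ResidueField A) R) x = x := by
  obtain ⟨x, rfl⟩ := Ideal.Quotient.mk_surjective x
  exact congrArg _ (preMap_id p m x)

theorem pointsMap_comp (f : R →ₐ[IsLocalRing.ResidueField A] S)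
    (g : S →ₐ[IsLocalRing.ResidueField A] T) (x : Points p m A R) :
    pointsMap p m (g.comp f) x = pointsMap p m g (pointsMap p m f x) := by
  obtain ⟨x, rfl⟩ := Ideal.Quotient.mk_surjective x
  exact congrArg _ (preMap_comp p m f g x)

variable (A)

/-- Greenberg's ring scheme attached to `A`, as a functor from `k`-algebras to `A`-algebras. -/
noncomputable def ringFunctor :
    CommAlgCat.{u} (IsLocalRing.ResidueField A) ⥤ CommAlgCat.{u} A where
  obj R := CommAlgCat.of A (Points p m A R)
  map f := CommAlgCat.ofHom (pointsMap p m f.hom)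
  map_id R := by
    ext x
    exact pointsMap_id p m x
  map_comp f g := by
    ext x
    exact pointsMap_comp p m f.hom g.hom x

end

end GreenbergRing

namespace GreenbergRing

section

attribute [local instance] wittAlgebra

variable (p m : ℕ) [Fact p.Prime] (A : Type u) [CommRing A] [IsLocalRing A]
  [Algebra (TruncatedWittVector p (m + 1) (IsLocalRing.ResidueField A)) A]
  (R : Type u) [CommRing R] [Algebra (IsLocalRing.ResidueField A) R]

/-- For `m = 0` one has `𝐀(R) = A ⊗_{W_m(k)} W_m(R)`, which is `A ⊗_k R`. -/
theorem relations_eq_bot_of_eq_zero (hm : m = 0) : relations p m A R = ⊥ := by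
  refine Ideal.span_eq_bot.2 ?_
  rintro _ ⟨n, a, w, ha, hw, rfl⟩
  rcases Nat.eq_zero_or_pos n with rfl | hn
  · rw [pow_zero, one_mul] at ha
    rw [ha, TensorProduct.zero_tmul]
  · have : w = 0 := by
      ext i
      rw [hw i (by omega), TruncatedWittVector.coeff_zero]
    rw [this, TensorProduct.tmul_zero]

/-- For `R` perfect of characteristic `p` one has `𝐀(R) = A ⊗_{W_m(k)} W_m(R)`. -/
theorem relations_eq_bot_of_perfectRing [CharP R p] [PerfectRing R p] :
    relations p m A R = ⊥ := by
  refine Ideal.span_eq_bot.2 ?_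
  rintro _ ⟨n, a, w, ha, hw, rfl⟩
  obtain ⟨y, hy⟩ : ∃ y : TruncatedWittVector p (m + 1) R, w = (p : _) ^ n * y := by
    have hout : ∀ i < n, w.out.coeff i = 0 := fun i hi => by
      by_cases h : i < m + 1
      · exact (TruncatedWittVector.coeff_out w ⟨i, h⟩).trans (hw ⟨i, h⟩ hi)
      · exact dif_neg h
    have hmem : w.out ∈ Ideal.span {(p : WittVector p R) ^ n} :=
      (WittVector.mem_span_p_pow_iff_le_coeff_eq_zero w.out n).2 hout
    obtain ⟨y, hy⟩ := Ideal.mem_span_singleton'.1 hmem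
    refine ⟨WittVector.truncate (m + 1) y, ?_⟩
    rw [← TruncatedWittVector.truncateFun_out w, mul_comm]
    change WittVector.truncate (m + 1) w.out = _
    rw [← hy, map_mul, map_pow, map_natCast]
  have h : w = (p ^ n : ℕ) • y := by rw [hy, nsmul_eq_mul]; push_cast; rfl
  rw [h, ← TensorProduct.smul_tmul, nsmul_eq_mul]
  push_cast
  rw [ha, TensorProduct.zero_tmul]

/-- If `A` has characteristic `p ^ (m + 1)` and is flat over `W_m(k)`, then
`𝐀(R) = A ⊗_{W_m(k)} W_m(R)` for all `R`. -/
theorem relations_eq_bot_of_flat [CharP (IsLocalRing.ResidueField A) p]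
    [Module.Flat (TruncatedWittVector p (m + 1) (IsLocalRing.ResidueField A)) A] :
    relations p m A R = ⊥ := by
  have : CharP R p ∨ Subsingleton R := by
    cases subsingleton_or_nontrivial R
    · exact Or.inr ‹_›
    · exact Or.inl (charP_of_injective_algebraMap
        (FaithfulSMul.algebraMap_injective (IsLocalRing.ResidueField A) R) p)
  refine Ideal.span_eq_bot.2 ?_
  rintro _ ⟨n, a, w, ha, hw, rfl⟩
  rcases this with hR | hR
  swap
  · have : w = 0 := by ext i; exact Subsingleton.elim _ _
    rw [this, TensorProduct.tmul_zero]
  have hrel : ∑ _i : Fin 1, ((p : TruncatedWittVector p (m + 1) (IsLocalRing.ResidueField A)) ^ n) •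
      a = 0 := by
    rw [Fin.sum_univ_one, Algebra.smul_def, map_pow, map_natCast, ha]
  obtain ⟨l, c, b, hb, hc⟩ := Module.Flat.isTrivialRelation_of_sum_smul_eq_zero
    (f := fun _ : Fin 1 => (p : TruncatedWittVector p (m + 1) (IsLocalRing.ResidueField A)) ^ n)
    (x := fun _ => a) hrel
  have hb0 : a = _ := hb 0
  rw [hb0, TensorProduct.sum_tmul]
  refine Finset.sum_eq_zero fun j _ => ?_
  rw [TensorProduct.smul_tmul]
  suffices h : c 0 j • w = 0 by rw [h, TensorProduct.tmul_zero]
  have hcj : (p : TruncatedWittVector p (m + 1) (IsLocalRing.ResidueField A)) ^ n * c 0 j = 0 := by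
    simpa using hc j
  rw [Algebra.smul_def]
  change TruncatedWittVector.map p (m + 1) (algebraMap _ R) (c 0 j) * w = 0
  generalize c 0 j = d at hcj ⊢
  obtain ⟨d, rfl⟩ := WittVector.truncate_surjective p (m + 1) _ d
  obtain ⟨w, rfl⟩ := WittVector.truncate_surjective p (m + 1) _ w
  rw [TruncatedWittVector.map_truncate, ← map_mul, ← RingHom.mem_ker,
    WittVector.mem_ker_truncate]
  rw [← map_natCast (WittVector.truncate (m + 1)), ← map_pow, ← map_mul, ← RingHom.mem_ker,
    WittVector.mem_ker_truncate] at hcj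
  have hd : ∀ i < m + 1 - n, d.coeff i = 0 := fun i hi => by
    have h := hcj (i + n) (by omega)
    rw [mul_comm, WittVector.mul_pow_charP_coeff_succ] at h
    exact eq_zero_of_pow_eq_zero h
  have hw' : ∀ i < min n (m + 1), w.coeff i = 0 := fun i hi =>
    hw ⟨i, by omega⟩ (by simpa using (lt_min_iff.1 hi).1)
  have hd' : ∀ i < m + 1 - n, (WittVector.map (algebraMap _ R) d).coeff i = 0 := fun i hi => by
    rw [WittVector.map_coeff, hd i hi, map_zero]
  intro i hi
  rw [WittVector.eq_iterate_verschiebung hd', WittVector.eq_iterate_verschiebung hw',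
    WittVector.iterate_verschiebung_mul,
    WittVector.iterate_verschiebung_coeff_eq_zero _ (by omega)]

end

end GreenbergRing

/-! ### Group functors and identity components -/

/-- Group functors over `R`: functors from `R`-algebras to groups. -/
abbrev GroupFunctor (R : Type u) [CommRing R] := CommAlgCat.{u} R ⥤ GrpCat.{u}

/-- Restriction of scalars, from `S`-algebras to `R`-algebras, for an `R`-algebra `S`. -/
noncomputable def restrictScalarsFunctor (R S : Type u) [CommRing R] [CommRing S] [Algebra R S] :
    CommAlgCat.{u} S ⥤ CommAlgCat.{u} R where
  obj T := @CommAlgCat.of R _ T _ (Algebra.compHom T (algebraMap R S))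
  map {T T'} f := @CommAlgCat.ofHom R _ T T' _ (Algebra.compHom T (algebraMap R S)) _
    (Algebra.compHom T' (algebraMap R S))
    (@AlgHom.mk R T T' _ _ _ (Algebra.compHom T (algebraMap R S))
      (Algebra.compHom T' (algebraMap R S)) (f.hom : T →+* T')
      fun r => f.hom.commutes (algebraMap R S r))

namespace GroupFunctor

variable {R : Type u} [CommRing R]

/-- The base extension `𝒢_S` of a group functor over `R` to an `R`-algebra `S`. -/
noncomputable def baseChange (𝒢 : GroupFunctor R) (S : Type u) [CommRing S] [Algebra R S] : GroupFunctor S :=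
  restrictScalarsFunctor R S ⋙ 𝒢

/-- The point of the scheme `Spec B` given by an element of `𝒢(K)`, for a group functor `𝒢` over a
field `K` represented by the `K`-algebra `B`: the kernel of the corresponding map `B → K`. -/
noncomputable def point {K : Type u} [Field K] {𝒢 : GroupFunctor K} {B : CommAlgCat.{u} K}
    (r : (𝒢 ⋙ forget GrpCat).CorepresentableBy B) (g : 𝒢.obj (CommAlgCat.of K K)) :
    PrimeSpectrum B :=
  PrimeSpectrum.comap (r.homEquiv.symm (g : (𝒢 ⋙ forget GrpCat).obj (CommAlgCat.of K K))).hom.toRingHom ⊥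

/-- The `K`-points of the identity component of a group functor over a field `K` which is
(represented by) an affine group scheme `Spec B`: the elements whose point of `Spec B` lies in the
connected component of the identity. The choice of `B` is immaterial; if the functor is not
representable by an affine scheme, there is no such element. -/
def identityComponentPoints {K : Type u} [Field K] (𝒢 : GroupFunctor K) :
    Set (𝒢.obj (CommAlgCat.of K K)) :=
  {g | ∃ (B : CommAlgCat.{u} K) (r : (𝒢 ⋙ forget GrpCat).CorepresentableBy B),
    point r g ∈ connectedComponent (point r 1)}

/-- The map `S → κ(s)` to the residue field at a point `s` of `Spec S`, as a map of
`R`-algebras. -/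
noncomputable def toResidueField (S : CommAlgCat.{u} R) (s : PrimeSpectrum S) :
    S ⟶ (restrictScalarsFunctor R s.asIdeal.ResidueField).obj
      (CommAlgCat.of s.asIdeal.ResidueField s.asIdeal.ResidueField) :=
  @CommAlgCat.ofHom R _ S s.asIdeal.ResidueField _ _ _
    (Algebra.compHom s.asIdeal.ResidueField (algebraMap R s.asIdeal.ResidueField))
    (@AlgHom.mk R S s.asIdeal.ResidueField _ _ _ _
      (Algebra.compHom s.asIdeal.ResidueField (algebraMap R s.asIdeal.ResidueField))
      (algebraMap S s.asIdeal.ResidueField)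
      fun r => (IsScalarTower.algebraMap_apply R S s.asIdeal.ResidueField r).symm)

/-- The value `g_s ∈ 𝒢(κ(s)) = 𝒢_{κ(s)}(κ(s))` of `g ∈ 𝒢(S)` at a point `s` of `Spec S`. -/
noncomputable def valueAt (𝒢 : GroupFunctor R) {S : CommAlgCat.{u} R} (g : 𝒢.obj S) (s : PrimeSpectrum S) :
    (𝒢.baseChange s.asIdeal.ResidueField).obj
      (CommAlgCat.of s.asIdeal.ResidueField s.asIdeal.ResidueField) :=
  𝒢.map (toResidueField S s) g

/-- The identity component `𝒢⁰` of a group functor `𝒢` over `R`, as a family of subsets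
`𝒢⁰(S) ⊆ 𝒢(S)`: the elements all of whose values at the points `s` of `Spec S` lie in the identity
component of the fibre `𝒢_{κ(s)}`. -/
def identityComponent (𝒢 : GroupFunctor R) (S : CommAlgCat.{u} R) : Set (𝒢.obj S) :=
  {g | ∀ s : PrimeSpectrum S,
    𝒢.valueAt g s ∈ identityComponentPoints (𝒢.baseChange s.asIdeal.ResidueField)}

end GroupFunctor

/-! ### The Greenberg functor -/

section

variable (p m : ℕ) [Fact p.Prime] (A : Type u) [CommRing A] [IsLocalRing A]
  [Algebra (TruncatedWittVector p (m + 1) (IsLocalRing.ResidueField A)) A]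

/-- The Greenberg functor `(ℱ𝒢)(R) = 𝒢(𝐀(R))`, on group functors. -/
noncomputable def greenberg (𝒢 : GroupFunctor A) : GroupFunctor (IsLocalRing.ResidueField A) :=
  GreenbergRing.ringFunctor p m A ⋙ 𝒢

/-- The Greenberg functor on a subfunctor `𝒴` of a group functor `𝒢`, as a subfunctor of `ℱ𝒢`:
`(ℱ𝒴)(R) = 𝒴(𝐀(R)) ⊆ 𝒢(𝐀(R)) = (ℱ𝒢)(R)`. -/
def greenbergSub {𝒢 : GroupFunctor A} (𝒴 : ∀ S : CommAlgCat.{u} A, Set (𝒢.obj S))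
    (R : CommAlgCat.{u} (IsLocalRing.ResidueField A)) : Set ((greenberg p m A 𝒢).obj R) :=
  𝒴 ((GreenbergRing.ringFunctor p m A).obj R)

end

/-! ### Truncated Witt vectors -/

namespace TruncatedWittVector

variable {p n : ℕ} [Fact p.Prime]

/-! The projection `proj` from 𝐀(R) to R, `a ⊗ w ↦ ā w₀`, is surjective with nilpotent kernel: the
kernel is generated by the maximal ideal of A and by V W_m(R), and the square of the latter ideal
lies in p times it, where p is nilpotent (for m = 0 the latter ideal is zero). Hence Spec 𝐀(R) and
Spec R have the same points and the same residue fields (`specProj_surjective`,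
`residueFieldEquiv`), and membership in 𝒢⁰(𝐀(R)) is tested on images in 𝒢(κ(s)), s ∈ Spec R. It
remains to prove, for a field K over k, that g ∈ 𝒢(𝐀(K)) lies in the identity component of (ℱ𝒢)_K
exactly when its image in 𝒢(K) lies in that of 𝒢_K (`mem_identityComponentPoints_greenberg_iff`).

One direction is continuity of (ℱ𝒢)_K → 𝒢_K. For the other, formal smoothness lifts the universal
point of 𝒢_K, which gives a section of this map as a map of schemes; a section carries a connected
component into one component. The section need not pass through g or 1, but K-points with the same
image in 𝒢(K) are joined by an affine line: they are the values at 0 and 1 of a point of 𝒢(𝐀(K[X])),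
obtained again by formal smoothness (`exists_path`).

The identity component of (ℱ𝒢)_K makes sense only if this functor is affine. The structure theorem
for modules over W(k) (linear algebra over k if m = 0) decomposes A into modules W_{n i}(k); the
components of the corresponding Witt vectors are coordinates that make 𝐀 an affine space
(`coord_bijective`), and Hom(H, 𝐀(R)) is then defined by polynomial equations
(`HasCoordinates.exists_homEquiv`). -/

theorem truncate_map {l : ℕ} (h : l ≤ n) {R S : Type u} [CommRing R] [CommRing S] (f : R →+* S)
    (x : TruncatedWittVector p n R) :
    truncate h (map p n f x) = map p l f (truncate h x) := by
  ext i; simp [coeff_truncate]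

/-- The projection of `W_m` to the first component. -/
noncomputable def constantCoeff (p m : ℕ) [Fact p.Prime] (R : Type u) [CommRing R] :
    TruncatedWittVector p (m + 1) R →+* R :=
  RingHom.liftOfSurjective (WittVector.truncate (m + 1))
    (WittVector.truncate_surjective p (m + 1) R)
    ⟨WittVector.constantCoeff, fun x hx =>
      (WittVector.mem_ker_truncate _ x).1 hx 0 (Nat.succ_pos m)⟩

@[simp]
theorem constantCoeff_apply {m : ℕ} {R : Type u} [CommRing R]
    (x : TruncatedWittVector p (m + 1) R) : constantCoeff p m R x = x.coeff 0 := by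
  obtain ⟨x, rfl⟩ := WittVector.truncate_surjective p (m + 1) R x
  exact RingHom.liftOfRightInverse_comp_apply _ _
    (Function.rightInverse_surjInv (WittVector.truncate_surjective p (m + 1) R)) _ x

/-- Vectors whose first components vanish form the kernel of a truncation, hence an ideal. -/
theorem coeff_mul_eq_zero {R : Type u} [CommRing R] (v : TruncatedWittVector p n R)
    {w : TruncatedWittVector p n R} {j : ℕ} (hw : ∀ i : Fin n, (i : ℕ) < j → w.coeff i = 0)
    (i : Fin n) (hi : (i : ℕ) < j) : (v * w).coeff i = 0 := by
  obtain ⟨v, rfl⟩ := WittVector.truncate_surjective p n R v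
  obtain ⟨w, rfl⟩ := WittVector.truncate_surjective p n R w
  have h : w ∈ RingHom.ker (WittVector.truncate (i + 1) : WittVector p R →+* _) := by
    rw [WittVector.mem_ker_truncate]
    intro l hl
    exact (WittVector.coeff_truncate w ⟨l, by omega⟩).symm.trans (hw _ (by change l < j; omega))
  have h' := Ideal.mul_mem_left _ v h
  rw [WittVector.mem_ker_truncate] at h'
  rw [← map_mul, WittVector.coeff_truncate]
  exact h' i (Nat.lt_succ_self _)

/-- If `p ^ n` annihilates `d` and the first `n` components of `w` vanish then `d * w = 0`. -/
theorem map_mul_eq_zero_of_pow_mul_eq_zero {k R : Type u} [Field k] [CommRing R] [CharP k p]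
    [Algebra k R] {l j : ℕ} (d : TruncatedWittVector p l k) (w : TruncatedWittVector p l R)
    (hd : (p : TruncatedWittVector p l k) ^ j * d = 0)
    (hw : ∀ i : Fin l, (i : ℕ) < j → w.coeff i = 0) :
    map p l (algebraMap k R) d * w = 0 := by
  cases subsingleton_or_nontrivial R
  · ext i; exact Subsingleton.elim _ _
  have : CharP R p :=
    charP_of_injective_algebraMap (FaithfulSMul.algebraMap_injective k R) p
  obtain ⟨d, rfl⟩ := WittVector.truncate_surjective p l _ d
  obtain ⟨w, rfl⟩ := WittVector.truncate_surjective p l _ w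
  rw [map_truncate, ← map_mul, ← RingHom.mem_ker, WittVector.mem_ker_truncate]
  rw [← map_natCast (WittVector.truncate l), ← map_pow, ← map_mul, ← RingHom.mem_ker,
    WittVector.mem_ker_truncate] at hd
  -- In characteristic p, multiplication by `p ^ j` shifts components by j places and raises them to
  -- the power `p ^ j`; k is reduced, so `d` is an (l - j)-fold Verschiebung. As `w` is a `min j
  -- l`-fold one, the product is an l-fold one.
  have hd1 : ∀ i < l - j, d.coeff i = 0 := fun i hi => by
    have h := hd (i + j) (by omega)
    rw [mul_comm, WittVector.mul_pow_charP_coeff_succ] at h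
    exact eq_zero_of_pow_eq_zero h
  have hw' : ∀ i < min j l, w.coeff i = 0 := fun i hi =>
    (WittVector.coeff_truncate w ⟨i, by omega⟩).symm.trans
      (hw ⟨i, by omega⟩ (by change i < j; omega))
  have hd' : ∀ i < l - j, (WittVector.map (algebraMap k R) d).coeff i = 0 := fun i hi => by
    rw [WittVector.map_coeff, hd1 i hi, map_zero]
  intro i hi
  rw [WittVector.eq_iterate_verschiebung hd', WittVector.eq_iterate_verschiebung hw',
    WittVector.iterate_verschiebung_mul,
    WittVector.iterate_verschiebung_coeff_eq_zero _ (by omega)]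

/-- The product of two elements of `V W_m(R)` lies in `p V W_m(R)`. -/
theorem exists_natCast_mul_of_coeff_zero {R : Type u} [CommRing R] {m : ℕ}
    {x y : TruncatedWittVector p (m + 1) R} (hx : x.coeff 0 = 0) (hy : y.coeff 0 = 0) :
    ∃ z : TruncatedWittVector p (m + 1) R, z.coeff 0 = 0 ∧ x * y = p * z := by
  obtain ⟨x, rfl⟩ := WittVector.truncate_surjective p (m + 1) R x
  obtain ⟨y, rfl⟩ := WittVector.truncate_surjective p (m + 1) R y
  rw [WittVector.coeff_truncate] at hx hy
  have key : ∀ v : WittVector p R, v.coeff 0 = 0 → v = WittVector.verschiebung (v.shift 1) :=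
    fun v hv => WittVector.eq_iterate_verschiebung (n := 1) (by
      intro i hi
      obtain rfl : i = 0 := by omega
      exact hv)
  refine ⟨WittVector.truncate (m + 1) (WittVector.verschiebung (x.shift 1 * y.shift 1)), ?_, ?_⟩
  · rw [WittVector.coeff_truncate]
    exact WittVector.verschiebung_coeff_zero _
  · rw [← map_mul, ← map_natCast (WittVector.truncate (m + 1)), ← map_mul]
    congr 1
    conv_lhs => rw [key x hx, key y hy]
    -- Vx · Vy = V(x · FVy) = V(x · py) = p V(xy).
    rw [← WittVector.verschiebung_mul_frobenius, WittVector.frobenius_verschiebung, ← mul_assoc,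
      mul_comm _ (p : WittVector p R), ← nsmul_eq_mul, map_nsmul, nsmul_eq_mul]

end TruncatedWittVector

/-! ### The structure of an Artinian local ring as a module over a ring mapping onto `k` -/

/-- Generators over A of a power of the maximal ideal generate it over O modulo the next power,
because there the coefficients matter only through their residues, and these come from O. The
maximal ideal is nilpotent, so finitely many steps suffice. -/
theorem IsLocalRing.finite_of_residue_surjective {O A : Type*} [CommRing O] [CommRing A]
    [IsLocalRing A] [IsArtinianRing A] [Algebra O A]
    (h : ∀ x, ∃ c : O, IsLocalRing.residue A (algebraMap O A c) = x) : Module.Finite O A := by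
  have step : ∀ j : ℕ, ∃ T : Set A, T.Finite ∧
      ∀ x : A, ∃ y ∈ Submodule.span O T, x - y ∈ IsLocalRing.maximalIdeal A ^ j := by
    intro j
    induction j with
    | zero => exact ⟨∅, Set.finite_empty, fun x => ⟨0, zero_mem _, by simp⟩⟩
    | succ j ih =>
      obtain ⟨T, hT, hT'⟩ := ih
      obtain ⟨s, hs⟩ := IsNoetherian.noetherian (IsLocalRing.maximalIdeal A ^ j)
      refine ⟨T ∪ s, hT.union s.finite_toSet, fun x => ?_⟩
      obtain ⟨y, hy, hxy⟩ := hT' x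
      have key : ∀ z ∈ Submodule.span A (s : Set A), ∃ y ∈ Submodule.span O (s : Set A),
          z - y ∈ IsLocalRing.maximalIdeal A ^ (j + 1) := by
        intro z hz
        rw [Submodule.mem_span_finset] at hz
        obtain ⟨f, -, rfl⟩ := hz
        choose c hc using fun t => h (IsLocalRing.residue A (f t))
        refine ⟨∑ t ∈ s, c t • t, Submodule.sum_mem _ fun t ht =>
          Submodule.smul_mem _ _ (Submodule.subset_span ht), ?_⟩
        rw [← Finset.sum_sub_distrib]
        refine Submodule.sum_mem _ fun t ht => ?_
        rw [smul_eq_mul, Algebra.smul_def, ← sub_mul, pow_succ']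
        refine Ideal.mul_mem_mul ?_ ?_
        · rw [← IsLocalRing.residue_eq_zero_iff, map_sub, hc, sub_self]
        · rw [← hs]; exact Submodule.subset_span ht
      obtain ⟨z, hz, hz'⟩ := key (x - y) (by rw [hs]; exact hxy)
      refine ⟨y + z, add_mem (Submodule.span_mono Set.subset_union_left hy)
        (Submodule.span_mono Set.subset_union_right hz), ?_⟩
      rwa [← sub_sub]
  obtain ⟨M, hM⟩ := IsWittAlgebra.isNilpotent_maximalIdeal A
  obtain ⟨T, hT, hT'⟩ := step M
  refine ⟨Submodule.fg_def.2 ⟨T, hT, eq_top_iff.2 fun x _ => ?_⟩⟩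
  obtain ⟨y, hy, hxy⟩ := hT' x
  rw [hM, Ideal.zero_eq_bot, Ideal.mem_bot, sub_eq_zero] at hxy
  rwa [hxy]

namespace IsWittAlgebra

variable (p m : ℕ) [Fact p.Prime] (A : Type u) [CommRing A] [IsLocalRing A] [IsArtinianRing A]
  [Algebra (TruncatedWittVector p (m + 1) (IsLocalRing.ResidueField A)) A]

/-- `A` is a finite product of modules `W_{n i}(k)` over `W_m(k)`. -/
def HasWittDecomposition : Prop :=
  ∃ (ι : Type u) (_ : Finite ι) (n : ι → ℕ) (hn : ∀ i, n i ≤ m + 1)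
    (e : A ≃+ ∀ i, TruncatedWittVector p (n i) (IsLocalRing.ResidueField A)),
    ∀ c a i, e (algebraMap _ A c * a) i = TruncatedWittVector.truncate (hn i) c * e a i

theorem finite [IsWittAlgebra p m A] :
    Module.Finite (TruncatedWittVector p (m + 1) (IsLocalRing.ResidueField A)) A :=
  IsLocalRing.finite_of_residue_surjective fun x => ⟨TruncatedWittVector.mk p fun _ => x, by
    rw [residue_algebraMap, TruncatedWittVector.coeff_mk]⟩

/-- W_0(k) is the field k, so A has a finite basis over it and all `n i` equal 1. -/
theorem hasWittDecomposition_zero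
    [Algebra (TruncatedWittVector p (0 + 1) (IsLocalRing.ResidueField A)) A]
    [IsWittAlgebra p 0 A] : HasWittDecomposition p 0 A := by
  have hfin := finite p 0 A
  have hinj : Function.Injective (TruncatedWittVector.constantCoeff p 0
      (IsLocalRing.ResidueField A)) := fun x y h => by
    ext i
    obtain rfl : i = 0 := Fin.ext (by omega)
    simpa using h
  have hsurj : Function.Surjective (TruncatedWittVector.constantCoeff p 0
      (IsLocalRing.ResidueField A)) := fun x =>
    ⟨TruncatedWittVector.mk p fun _ => x, by
      rw [TruncatedWittVector.constantCoeff_apply, TruncatedWittVector.coeff_mk]⟩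
  have hfield : IsField (TruncatedWittVector p (0 + 1) (IsLocalRing.ResidueField A)) :=
    MulEquiv.isField (Field.toIsField (IsLocalRing.ResidueField A))
      (RingEquiv.ofBijective _ ⟨hinj, hsurj⟩).toMulEquiv
  let := hfield.toField
  let b := Module.Free.chooseBasis
    (TruncatedWittVector p (0 + 1) (IsLocalRing.ResidueField A)) A
  refine ⟨_, inferInstance, fun _ => 0 + 1, fun _ => le_rfl, b.equivFun.toAddEquiv,
    fun c a i => ?_⟩
  have h : TruncatedWittVector.truncate (p := p) (R := IsLocalRing.ResidueField A)
      (le_refl (0 + 1)) c = c := by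
    ext i; rw [TruncatedWittVector.coeff_truncate]; rfl
  rw [h]
  exact congrFun ((congrArg b.equivFun (Algebra.smul_def c a).symm).trans
    (map_smul b.equivFun c a)) i

/-- A is a finite torsion module over the discrete valuation ring W(k), hence a direct sum of
quotients W(k)/(p ^ n i), and these are the W_{n i}(k) because k is perfect. -/
theorem hasWittDecomposition_of_charP [CharP A (p ^ (m + 1))]
    [PerfectField (IsLocalRing.ResidueField A)] [IsWittAlgebra p m A] :
    HasWittDecomposition p m A := by
  have : CharP (IsLocalRing.ResidueField A) p := charP_residueField p m A
  have : ExpChar (IsLocalRing.ResidueField A) p := ExpChar.prime Fact.out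
  have : PerfectRing (IsLocalRing.ResidueField A) p := PerfectField.toPerfectRing p
  let O := WittVector p (IsLocalRing.ResidueField A)
  let : Algebra O A := ((algebraMap _ A).comp (WittVector.truncate (m + 1))).toAlgebra
  have halg : ∀ c : O, algebraMap O A c = algebraMap _ A (WittVector.truncate (m + 1) c) :=
    fun _ => rfl
  have hfin : Module.Finite O A := IsLocalRing.finite_of_residue_surjective fun x =>
    ⟨WittVector.teichmuller p x, by
      rw [halg, residue_algebraMap, WittVector.coeff_truncate]
      exact WittVector.teichmuller_coeff_zero p x⟩
  have hp0 : (p : A) ^ (m + 1) = 0 := by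
    have := CharP.cast_eq_zero A (p ^ (m + 1))
    push_cast at this
    exact this
  have hpO : (p : O) ≠ 0 := (WittVector.irreducible p).ne_zero
  have hsmul : ∀ a : A, ((p : O) ^ (m + 1)) • a = 0 := fun a => by
    rw [Algebra.smul_def, map_pow, map_natCast, hp0, zero_mul]
  have htors : Module.IsTorsion O A := fun {a} =>
    ⟨⟨(p : O) ^ (m + 1), mem_nonZeroDivisors_of_ne_zero (pow_ne_zero _ hpO)⟩, hsmul a⟩
  obtain ⟨ι, hι, q, hq, n, ⟨e⟩⟩ := Module.equiv_directSum_of_isTorsion htors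
  have hass : ∀ i, Associated (q i) (p : O) := fun i =>
    IsDiscreteValuationRing.associated_of_irreducible _ (hq i) (WittVector.irreducible p)
  have hspan : ∀ i, Ideal.span {q i ^ n i} = Ideal.span {(p : O) ^ n i} := fun i =>
    Ideal.span_singleton_eq_span_singleton.2 ((hass i).pow_pow)
  classical
  let e' : A ≃ₗ[O] ∀ i, O ⧸ Ideal.span {q i ^ n i} :=
    e.trans (DirectSum.linearEquivFunOnFintype O ι _)
  -- `p ^ (m + 1)` annihilates A, so it annihilates the generator of each summand.
  have hn : ∀ i, n i ≤ m + 1 := fun i => by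
    have h1 : ((p : O) ^ (m + 1)) • (Pi.single i 1 : ∀ i, O ⧸ Ideal.span {q i ^ n i}) = 0 := by
      rw [← e'.apply_symm_apply (Pi.single i 1), ← map_smul, hsmul, map_zero]
    have h2 := congrFun h1 i
    rw [Pi.smul_apply, Pi.single_eq_same, Algebra.smul_def, mul_one, Pi.zero_apply,
      Ideal.Quotient.algebraMap_eq, Ideal.Quotient.eq_zero_iff_mem, hspan,
      Ideal.mem_span_singleton] at h2
    exact (pow_dvd_pow_iff hpO (WittVector.irreducible p).not_isUnit).1 h2
  -- Perfectness of k enters here: (p ^ n) consists of all vectors whose first n components vanish.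
  have hker : ∀ i, Ideal.span {q i ^ n i} = RingHom.ker (WittVector.truncate (n i) : O →+* _) := by
    intro i
    ext x
    rw [hspan, WittVector.mem_span_p_pow_iff_le_coeff_eq_zero, WittVector.mem_ker_truncate]
  let f : ∀ i, (O ⧸ Ideal.span {q i ^ n i}) ≃+*
      TruncatedWittVector p (n i) (IsLocalRing.ResidueField A) := fun i =>
    (Ideal.quotEquivOfEq (hker i)).trans
      (RingHom.quotientKerEquivOfSurjective (WittVector.truncate_surjective p (n i) _))
  have hf : ∀ i (c : O), f i (Ideal.Quotient.mk _ c) = WittVector.truncate (n i) c :=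
    fun i c => rfl
  refine ⟨ι, inferInstance, n, hn,
    e'.toAddEquiv.trans (AddEquiv.piCongrRight fun i => (f i).toAddEquiv), fun c a i => ?_⟩
  obtain ⟨c, rfl⟩ := WittVector.truncate_surjective p (m + 1) _ c
  change f i (e' (algebraMap O A c * a) i) = _ * f i (e' a i)
  rw [← Algebra.smul_def, map_smul, Pi.smul_apply, Algebra.smul_def, map_mul,
    Ideal.Quotient.algebraMap_eq, hf, TruncatedWittVector.truncate_wittVector_truncate]

theorem hasWittDecomposition [IsAlgClosed (IsLocalRing.ResidueField A)]
    (hchar : CharP A (p ^ (m + 1)) ∨ (CharP A 0 ∧ m = 0)) [IsWittAlgebra p m A] :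
    HasWittDecomposition p m A := by
  rcases hchar with h | ⟨-, rfl⟩
  · exact hasWittDecomposition_of_charP p m A
  · exact hasWittDecomposition_zero p A

end IsWittAlgebra

/-! ### Coordinates on the ring scheme attached to `A` -/

namespace GreenbergRing

section

attribute [local instance] wittAlgebra

variable (p m : ℕ) [Fact p.Prime] {A : Type u} [CommRing A] [IsLocalRing A]
  [Algebra (TruncatedWittVector p (m + 1) (IsLocalRing.ResidueField A)) A]
  {ι : Type u} {n : ι → ℕ} (hn : ∀ i, n i ≤ m + 1)
  (e : A ≃+ ∀ i, TruncatedWittVector p (n i) (IsLocalRing.ResidueField A))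
  (he : ∀ c a i, e (algebraMap _ A c * a) i = TruncatedWittVector.truncate (hn i) c * e a i)
  (R : Type u) [CommRing R] [Algebra (IsLocalRing.ResidueField A) R]

/-- The coordinates of an element of `A ⊗ W_m(R)`, for a decomposition of `A` as a product of
modules `W_{n i}(k)`. -/
noncomputable def preCoord : Pre p m A R →+ ∀ i, TruncatedWittVector p (n i) R :=
  TensorProduct.liftAddHom
    (AddMonoidHom.mk' (fun a => AddMonoidHom.mk'
      (fun w i => TruncatedWittVector.map p (n i) (algebraMap _ R) (e a i) *
        TruncatedWittVector.truncate (hn i) w)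
      (fun v w => by funext i; simp only [map_add, mul_add, Pi.add_apply]))
      (fun a b => by
        ext w i : 2
        simp only [map_add, add_mul, Pi.add_apply, AddMonoidHom.mk'_apply,
          AddMonoidHom.add_apply]))
    (fun c a w => by
      funext i
      simp only [AddMonoidHom.mk'_apply]
      rw [Algebra.smul_def, Algebra.smul_def, he, map_mul, map_mul,
        ← TruncatedWittVector.truncate_map]
      change _ = _ * (TruncatedWittVector.truncate (hn i)
        (TruncatedWittVector.map p (m + 1) (algebraMap _ R) c) * _)
      ring)

theorem preCoord_tmul (a : A) (w : TruncatedWittVector p (m + 1) R) (i : ι) :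
    preCoord p m hn e he R (a ⊗ₜ w) i = TruncatedWittVector.map p (n i) (algebraMap _ R) (e a i) *
      TruncatedWittVector.truncate (hn i) w := rfl

/-- The generators of `relations` are stable under multiplication by pure tensors, so the ideal is
already their additive span. This allows maps that are only additive, such as `preCoord`, to be
tested on generators. -/
theorem relations_generator_mul {z : Pre p m A R}
    (hz : ∃ (n : ℕ) (a : A) (w : TruncatedWittVector p (m + 1) R),
      (p : A) ^ n * a = 0 ∧ (∀ i : Fin (m + 1), (i : ℕ) < n → w.coeff i = 0) ∧ z = a ⊗ₜ w)
    (b : A) (v : TruncatedWittVector p (m + 1) R) :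
    ∃ (n : ℕ) (a : A) (w : TruncatedWittVector p (m + 1) R),
      (p : A) ^ n * a = 0 ∧ (∀ i : Fin (m + 1), (i : ℕ) < n → w.coeff i = 0) ∧
        b ⊗ₜ v * z = a ⊗ₜ w := by
  obtain ⟨n, a, w, ha, hw, rfl⟩ := hz
  refine ⟨n, b * a, v * w, by rw [mul_left_comm, ha, mul_zero],
    TruncatedWittVector.coeff_mul_eq_zero v hw, ?_⟩
  rw [Algebra.TensorProduct.tmul_mul_tmul]

theorem preCoord_relations (hk : CharP (IsLocalRing.ResidueField A) p ∨ m = 0) :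
    ∀ z ∈ relations p m A R, preCoord p m hn e he R z = 0 := by
  -- The coordinate map is not linear over A ⊗ W_m(R); the induction over the span therefore has to
  -- carry all multiples of `z`.
  suffices h : ∀ z ∈ relations p m A R, ∀ x, preCoord p m hn e he R (x * z) = 0 by
    intro z hz
    simpa using h z hz 1
  intro z hz
  refine Submodule.span_induction ?_ ?_ ?_ ?_ hz
  · intro z hz x
    induction x using TensorProduct.induction_on with
    | zero => rw [zero_mul, map_zero]
    | add x y hx hy => rw [add_mul, map_add, hx, hy, add_zero]
    | tmul b v =>
      obtain ⟨j, a, w, ha, hw, h⟩ := relations_generator_mul p m R hz b v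
      rw [h]
      funext i
      rw [preCoord_tmul, Pi.zero_apply]
      rcases hk with hk | rfl
      · refine TruncatedWittVector.map_mul_eq_zero_of_pow_mul_eq_zero (j := j) _ _ ?_ fun l hl => ?_
        · have := he ((p : TruncatedWittVector p (m + 1) (IsLocalRing.ResidueField A)) ^ j) a i
          rw [map_pow, map_natCast, ha, map_zero, map_pow, map_natCast] at this
          exact this.symm
        · rw [TruncatedWittVector.coeff_truncate]
          exact hw _ hl
      -- Here m = 0 and p may be invertible: a generator vanishes because either j = 0 and `a = 0`,
      -- or the only component of `w` is zero.
      · rcases Nat.eq_zero_or_pos j with rfl | hj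
        · rw [pow_zero, one_mul] at ha
          rw [ha, map_zero, Pi.zero_apply, map_zero, zero_mul]
        · have : w = 0 := by
            ext l
            rw [hw l (by omega), TruncatedWittVector.coeff_zero]
          rw [this, map_zero, mul_zero]
  · intro x; rw [mul_zero, map_zero]
  · intro y z _ _ hy hz x; rw [mul_add, map_add, hy, hz, add_zero]
  · intro y z _ hz x; rw [smul_eq_mul, ← mul_assoc]; exact hz _

/-- The coordinates of an element of `𝐀(R)`. -/
noncomputable def coord (hk : CharP (IsLocalRing.ResidueField A) p ∨ m = 0) :
    Points p m A R →+ ∀ i, TruncatedWittVector p (n i) R :=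
  QuotientAddGroup.lift (relations p m A R).toAddSubgroup (preCoord p m hn e he R)
    (preCoord_relations p m hn e he R hk)

variable (hk : CharP (IsLocalRing.ResidueField A) p ∨ m = 0)

theorem coord_mk (z : Pre p m A R) :
    coord p m hn e he R hk (Ideal.Quotient.mk _ z) = preCoord p m hn e he R z := rfl

theorem coord_pointsMap {S : Type u} [CommRing S] [Algebra (IsLocalRing.ResidueField A) S]
    (f : R →ₐ[IsLocalRing.ResidueField A] S) (z : Points p m A R) (i : ι) :
    coord p m hn e he S hk (pointsMap p m f z) i =
      TruncatedWittVector.map p (n i) (f : R →+* S) (coord p m hn e he R hk z i) := by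
  obtain ⟨z, rfl⟩ := Ideal.Quotient.mk_surjective z
  change preCoord p m hn e he S (preMap p m f z) i =
    TruncatedWittVector.map p (n i) (f : R →+* S) (preCoord p m hn e he R z i)
  induction z using TensorProduct.induction_on with
  | zero => simp only [map_zero, Pi.zero_apply]
  | add x y hx hy => simp only [map_add, Pi.add_apply, hx, hy]
  | tmul a w =>
    change preCoord p m hn e he S (a ⊗ₜ TruncatedWittVector.map p (m + 1) (f : R →+* S) w) i = _
    rw [preCoord_tmul, preCoord_tmul, map_mul, TruncatedWittVector.map_map, AlgHom.comp_algebraMap,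
      TruncatedWittVector.truncate_map]

include he in
-- The elements of A corresponding to the unit vectors generate A over W_m(k), and scalars can be
-- moved across the tensor sign.
theorem exists_eq_sum_mk_tmul [Fintype ι] [DecidableEq ι] (z : Points p m A R) :
    ∃ w : ι → TruncatedWittVector p (m + 1) R,
      z = Ideal.Quotient.mk _ (∑ i, e.symm (Pi.single i 1) ⊗ₜ w i) := by
  obtain ⟨z, rfl⟩ := Ideal.Quotient.mk_surjective z
  suffices h : ∃ w : ι → TruncatedWittVector p (m + 1) R,
      z = ∑ i, e.symm (Pi.single i 1) ⊗ₜ w i by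
    obtain ⟨w, rfl⟩ := h
    exact ⟨w, rfl⟩
  induction z using TensorProduct.induction_on with
  | zero => exact ⟨0, by simp⟩
  | add x y hx hy =>
    obtain ⟨v, rfl⟩ := hx
    obtain ⟨w, rfl⟩ := hy
    exact ⟨v + w, by simp only [Pi.add_apply, TensorProduct.tmul_add, Finset.sum_add_distrib]⟩
  | tmul a w =>
    choose c hc using fun i => TruncatedWittVector.truncate_surjective (hn i) (e a i)
    have ha : a = ∑ i, c i • e.symm (Pi.single i 1) := by
      apply e.injective
      rw [map_sum]
      funext j
      rw [Finset.sum_apply, Finset.sum_eq_single j]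
      · rw [Algebra.smul_def, he, e.apply_symm_apply, Pi.single_eq_same, mul_one, hc]
      · intro i _ hij
        rw [Algebra.smul_def, he, e.apply_symm_apply, Pi.single_eq_of_ne hij.symm, mul_zero]
      · simp
    refine ⟨fun i => c i • w, ?_⟩
    conv_lhs => rw [ha]
    rw [TensorProduct.sum_tmul]
    simp only [TensorProduct.smul_tmul]

theorem preCoord_sum [Fintype ι] [DecidableEq ι] (w : ι → TruncatedWittVector p (m + 1) R) (j : ι) :
    preCoord p m hn e he R (∑ i, e.symm (Pi.single i 1) ⊗ₜ w i) j =
      TruncatedWittVector.truncate (hn j) (w j) := by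
  rw [map_sum, Finset.sum_apply, Finset.sum_eq_single j]
  · rw [preCoord_tmul, e.apply_symm_apply, Pi.single_eq_same, map_one, one_mul]
  · intro i _ hij
    rw [preCoord_tmul, e.apply_symm_apply, Pi.single_eq_of_ne hij.symm, map_zero, zero_mul]
  · simp

/-- The coordinates of `∑ eᵢ ⊗ wᵢ` are the truncations of the `wᵢ`, which gives surjectivity. If
they vanish, then the first `n i` components of `wᵢ` are zero while `p ^ n i` annihilates `eᵢ`, so
each `eᵢ ⊗ wᵢ` is one of the defining relations. -/
theorem coord_bijective [Finite ι] : Function.Bijective (coord p m hn e he R hk) := by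
  classical
  have := Fintype.ofFinite ι
  constructor
  · rw [injective_iff_map_eq_zero]
    intro z hz
    obtain ⟨w, rfl⟩ := exists_eq_sum_mk_tmul p m hn e he R z
    rw [coord_mk] at hz
    rw [Ideal.Quotient.eq_zero_iff_mem]
    have hw : ∀ i (l : Fin (m + 1)), (l : ℕ) < n i → (w i).coeff l = 0 := fun i l hl => by
      have := congrArg (TruncatedWittVector.coeff (⟨l, hl⟩ : Fin (n i))) (congrFun hz i)
      rw [preCoord_sum, TruncatedWittVector.coeff_truncate, Pi.zero_apply,
        TruncatedWittVector.coeff_zero] at this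
      exact this
    refine Submodule.sum_mem _ fun i _ => ?_
    -- If `n i = m + 1` then `wᵢ` itself is zero. Removing this case leaves only `n i = 0` when m =
    -- 0, where `p ^ n i` need not annihilate W_{n i}(k) otherwise.
    by_cases hi : m < n i
    · have : w i = 0 := by
        ext l
        rw [hw i l (by omega), TruncatedWittVector.coeff_zero]
      rw [this, TensorProduct.tmul_zero]
      exact zero_mem _
    refine Ideal.subset_span ⟨n i, _, w i, ?_, hw i, rfl⟩
    apply e.injective
    rw [map_zero]
    funext j
    have h := he ((p : TruncatedWittVector p (m + 1) (IsLocalRing.ResidueField A)) ^ n i)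
      (e.symm (Pi.single i 1)) j
    rw [map_pow, map_natCast, e.apply_symm_apply] at h
    rw [h, Pi.zero_apply]
    rcases eq_or_ne j i with rfl | hij
    swap
    · rw [Pi.single_eq_of_ne hij, mul_zero]
    rw [Pi.single_eq_same, mul_one]
    rcases hk with hk | rfl
    · have h2 : (p : TruncatedWittVector p (n j) (IsLocalRing.ResidueField A)) ^ n j =
          WittVector.truncate (n j) (1 * (p : WittVector p (IsLocalRing.ResidueField A)) ^ n j) := by
        rw [one_mul, map_pow, map_natCast]
      rw [map_pow, map_natCast, h2, ← RingHom.mem_ker, WittVector.mem_ker_truncate]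
      intro l hl
      exact WittVector.mul_pow_charP_coeff_zero _ hl
    · ext l
      exact absurd l.2 (by omega)
  · intro x
    choose w hw using fun i => TruncatedWittVector.truncate_surjective (hn i) (x i)
    refine ⟨Ideal.Quotient.mk _ (∑ i, e.symm (Pi.single i 1) ⊗ₜ w i), ?_⟩
    rw [coord_mk]
    funext j
    rw [preCoord_sum, hw]

end

end GreenbergRing

/-! ### Representability of the Greenberg functor -/

/-- A functor from `k`-algebras to `A`-algebras has coordinates if, as a functor to pointed sets, it
is isomorphic to an affine space `R ↦ (N → R)`. -/
def HasCoordinates {k A : Type u} [CommRing k] [CommRing A] (E : CommAlgCat.{u} k ⥤ CommAlgCat.{u} A) :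
    Prop :=
  ∃ (N : Type u) (c : ∀ R : CommAlgCat.{u} k, E.obj R ≃ (N → R)),
    (∀ (R S : CommAlgCat.{u} k) (f : R ⟶ S) (z : E.obj R) (i : N),
      c S ((E.map f).hom z) i = f.hom (c R z i)) ∧ ∀ R, c R 0 = 0

section

attribute [local instance] GreenbergRing.wittAlgebra

theorem GreenbergRing.hasCoordinates (p m : ℕ) [Fact p.Prime] (A : Type u) [CommRing A]
    [IsLocalRing A] [IsArtinianRing A]
    [Algebra (TruncatedWittVector p (m + 1) (IsLocalRing.ResidueField A)) A]
    (h : IsWittAlgebra.HasWittDecomposition p m A)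
    (hk : CharP (IsLocalRing.ResidueField A) p ∨ m = 0) :
    HasCoordinates (GreenbergRing.ringFunctor p m A) := by
  obtain ⟨ι, hι, n, hn, e, he⟩ := h
  let c : ∀ R : CommAlgCat.{u} (IsLocalRing.ResidueField A),
      (GreenbergRing.ringFunctor p m A).obj R ≃ ((Σ i, Fin (n i)) → R) := fun R =>
    (Equiv.ofBijective _ (coord_bijective p m hn e he R hk)).trans
      (Equiv.piCurry fun i (_ : Fin (n i)) => (R : Type u)).symm
  have hc : ∀ R z i, c R z i = (coord p m hn e he R hk z i.1).coeff i.2 := fun _ _ _ => rfl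
  refine ⟨_, c, fun R S f z i => ?_, fun R => ?_⟩
  · rw [hc, hc]
    refine (congrArg (TruncatedWittVector.coeff i.2)
      (coord_pointsMap p m hn e he R hk f.hom z i.1)).trans ?_
    exact TruncatedWittVector.coeff_map p (n i.1) _ _ _
  · funext i
    rw [hc]
    refine (congrArg (fun x : ∀ i, TruncatedWittVector p (n i) R => (x i.1).coeff i.2)
      (map_zero (coord p m hn e he R hk))).trans ?_
    exact TruncatedWittVector.coeff_zero p (n i.1) R i.2

end

/-- If `E` has coordinates then `R ↦ Hom(H, E(R))` is representable by an affine scheme. -/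
theorem HasCoordinates.exists_homEquiv {k A : Type u} [CommRing k] [CommRing A]
    {E : CommAlgCat.{u} k ⥤ CommAlgCat.{u} A} (hE : HasCoordinates E) (H : CommAlgCat.{u} A) :
    ∃ (B : CommAlgCat.{u} k) (u : H ⟶ E.obj B),
      ∀ R : CommAlgCat.{u} k, Function.Bijective fun f : B ⟶ R => u ≫ E.map f := by
  obtain ⟨N, c, hc, h0⟩ := hE
  -- The variable indexed by (x, i) stands for the i-th coordinate of the image of x under a
  -- homomorphism from H. `Z` collects the elements of E(Q) whose vanishing makes the generic map
  -- `v` a homomorphism of A-algebras, and `I` is generated by their coordinates.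
  let Q := CommAlgCat.of k (MvPolynomial (H × N) k)
  let v : H → E.obj Q := fun x => (c Q).symm fun i => MvPolynomial.X (x, i)
  let Z : Set (E.obj Q) := {z | (∃ x y, z = v (x + y) - (v x + v y)) ∨
    (∃ x y, z = v (x * y) - v x * v y) ∨ ∃ a : A, z = v (algebraMap A H a) - algebraMap A _ a}
  let I : Ideal (MvPolynomial (H × N) k) := Ideal.span {q | ∃ z ∈ Z, ∃ i, q = c Q z i}
  let B := CommAlgCat.of k (MvPolynomial (H × N) k ⧸ I)
  let π : Q ⟶ B := CommAlgCat.ofHom (Ideal.Quotient.mkₐ k I)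
  -- Since zero has zero coordinates, an element vanishes as soon as its coordinates do; no
  -- compatibility of the coordinates with addition is needed.
  have hZ : ∀ z ∈ Z, (E.map π).hom z = 0 := fun z hz => by
    apply (c B).injective
    rw [h0]
    funext i
    rw [hc]
    exact Ideal.Quotient.eq_zero_iff_mem.2 (Ideal.subset_span ⟨z, hz, i, rfl⟩)
  have hadd : ∀ x y, (E.map π).hom (v (x + y)) = (E.map π).hom (v x) + (E.map π).hom (v y) :=
    fun x y => by
      rw [← map_add, ← sub_eq_zero, ← map_sub]
      exact hZ _ (Or.inl ⟨x, y, rfl⟩)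
  have hmul : ∀ x y, (E.map π).hom (v (x * y)) = (E.map π).hom (v x) * (E.map π).hom (v y) :=
    fun x y => by
      rw [← map_mul, ← sub_eq_zero, ← map_sub]
      exact hZ _ (Or.inr (Or.inl ⟨x, y, rfl⟩))
  have halg : ∀ a : A, (E.map π).hom (v (algebraMap A H a)) = algebraMap A _ a := fun a => by
    rw [← (E.map π).hom.commutes, ← sub_eq_zero, ← map_sub]
    exact hZ _ (Or.inr (Or.inr ⟨a, rfl⟩))
  let u : H →ₐ[A] E.obj B :=
    { toFun := fun x => (E.map π).hom (v x)
      map_add' := hadd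
      map_mul' := hmul
      map_one' := by have := halg 1; rwa [map_one, map_one] at this
      map_zero' := by have := halg 0; rwa [map_zero, map_zero] at this
      commutes' := halg }
  have hu : ∀ (R : CommAlgCat.{u} k) (f : B ⟶ R) (x : H) (i : N),
      c R ((E.map f).hom (u x)) i = f.hom (Ideal.Quotient.mk I (MvPolynomial.X (x, i))) := by
    intro R f x i
    change c R ((E.map f).hom ((E.map π).hom (v x))) i = _
    rw [hc, hc, (c Q).apply_symm_apply]
    rfl
  refine ⟨B, CommAlgCat.ofHom u, fun R => ⟨fun f g hfg => ?_, fun φ => ?_⟩⟩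
  · apply CommAlgCat.hom_ext
    apply Ideal.Quotient.algHom_ext
    apply MvPolynomial.algHom_ext
    rintro ⟨x, i⟩
    have := congrArg (fun φ : H ⟶ E.obj R => c R (φ.hom x) i) hfg
    exact (hu R f x i).symm.trans (this.trans (hu R g x i))
  · let F : Q ⟶ R := CommAlgCat.ofHom (MvPolynomial.aeval fun xi : H × N => c R (φ.hom xi.1) xi.2)
    have hF : ∀ x, (E.map F).hom (v x) = φ.hom x := fun x => by
      apply (c R).injective
      funext i
      rw [hc, (c Q).apply_symm_apply]
      exact MvPolynomial.aeval_X _ _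
    have hFZ : ∀ z ∈ Z, (E.map F).hom z = 0 := by
      rintro z (⟨x, y, rfl⟩ | ⟨x, y, rfl⟩ | ⟨a, rfl⟩)
      · rw [map_sub, map_add, hF, hF, hF, map_add, sub_self]
      · rw [map_sub, map_mul, hF, hF, hF, map_mul, sub_self]
      · rw [map_sub, hF, AlgHom.commutes, AlgHom.commutes, sub_self]
    have hFI : ∀ q ∈ I, F.hom q = 0 := by
      intro q hq
      have : I ≤ RingHom.ker F.hom := Ideal.span_le.2 (by
        rintro _ ⟨z, hz, i, rfl⟩
        change F.hom _ = 0
        rw [← hc, hFZ z hz, h0]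
        rfl)
      exact this hq
    let f : B ⟶ R := CommAlgCat.ofHom (Ideal.Quotient.liftₐ I F.hom hFI)
    refine ⟨f, ?_⟩
    apply CommAlgCat.hom_ext
    ext x
    apply (c R).injective
    funext i
    refine (hu R f x i).trans ?_
    exact MvPolynomial.aeval_X _ _

/-! ### Representability of composite and base-extended group functors. -/

namespace GroupFunctor

variable {R : Type u} [CommRing R] {𝒢 : GroupFunctor R}

/-- The homomorphism corresponding to an element of a represented group functor. -/
def toHom {H : CommAlgCat.{u} R} (r : (𝒢 ⋙ forget GrpCat).CorepresentableBy H)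
    {T : CommAlgCat.{u} R} (x : 𝒢.obj T) : H ⟶ T :=
  r.homEquiv.symm (x : (𝒢 ⋙ forget GrpCat).obj T)

/-- The element of a represented group functor corresponding to a homomorphism. -/
def ofHom {H : CommAlgCat.{u} R} (r : (𝒢 ⋙ forget GrpCat).CorepresentableBy H)
    {T : CommAlgCat.{u} R} (f : H ⟶ T) : 𝒢.obj T :=
  r.homEquiv f

variable {H : CommAlgCat.{u} R} (r : (𝒢 ⋙ forget GrpCat).CorepresentableBy H)
  {T T' : CommAlgCat.{u} R}

@[simp]
theorem ofHom_toHom (x : 𝒢.obj T) : ofHom r (toHom r x) = x := r.homEquiv.apply_symm_apply x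

theorem toHom_map (f : T ⟶ T') (x : 𝒢.obj T) : toHom r (𝒢.map f x) = toHom r x ≫ f :=
  (r.homEquiv_symm_comp (x : (𝒢 ⋙ forget GrpCat).obj T) f).symm

theorem map_ofHom (f : H ⟶ T) (g : T ⟶ T') : 𝒢.map g (ofHom r f) = ofHom r (f ≫ g) :=
  (r.homEquiv_comp g f).symm

/-- A group functor is representable as soon as it has a universal element. -/
noncomputable def corepresentableByOfBijective (H : CommAlgCat.{u} R) (y : 𝒢.obj H)
    (hy : ∀ T, Function.Bijective fun f : H ⟶ T => 𝒢.map f y) :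
    (𝒢 ⋙ forget GrpCat).CorepresentableBy H where
  homEquiv {T} := Equiv.ofBijective (fun f : H ⟶ T => 𝒢.map f y) (hy T)
  homEquiv_comp g f := by
    change 𝒢.map (f ≫ g) y = 𝒢.map g (𝒢.map f y)
    rw [Functor.map_comp]
    rfl

include r in
-- 𝒢(E(T)) = Hom(H, E(T)), which is representable when E has coordinates.
theorem exists_corepresentableBy_comp {k : Type u} [CommRing k]
    {E : CommAlgCat.{u} k ⥤ CommAlgCat.{u} R} (hE : HasCoordinates E) :
    ∃ B : CommAlgCat.{u} k, Nonempty (((E ⋙ 𝒢 : GroupFunctor k) ⋙ forget GrpCat).CorepresentableBy B) := by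
  obtain ⟨B, u, hu⟩ := hE.exists_homEquiv H
  refine ⟨B, ⟨corepresentableByOfBijective B (ofHom r u : 𝒢.obj (E.obj B)) fun T => ?_⟩⟩
  have : (fun f : B ⟶ T => (E ⋙ 𝒢).map f (ofHom r u : 𝒢.obj (E.obj B))) =
      r.homEquiv ∘ fun f : B ⟶ T => u ≫ E.map f := by
    funext f
    exact map_ofHom r u (E.map f)
  exact this ▸ r.homEquiv.bijective.comp (hu T)

/-- The base extension of an affine group scheme is affine. -/
theorem exists_corepresentableBy_baseChange (r : (𝒢 ⋙ forget GrpCat).CorepresentableBy H)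
    (S : Type u) [CommRing S] [Algebra R S] :
    ∃ B : CommAlgCat.{u} S, Nonempty ((𝒢.baseChange S ⋙ forget GrpCat).CorepresentableBy B) := by
  let B := CommAlgCat.of S (S ⊗[R] H)
  let u : H ⟶ (restrictScalarsFunctor R S).obj B :=
    @CommAlgCat.ofHom R _ H (S ⊗[R] H) _ _ _ (Algebra.compHom (S ⊗[R] H) (algebraMap R S))
      (@AlgHom.mk R H (S ⊗[R] H) _ _ _ _ (Algebra.compHom (S ⊗[R] H) (algebraMap R S))
        (Algebra.TensorProduct.includeRight : H →ₐ[R] S ⊗[R] H).toRingHom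
        fun a => (Algebra.TensorProduct.includeRight : H →ₐ[R] S ⊗[R] H).commutes a)
  refine ⟨B, ⟨corepresentableByOfBijective B (ofHom r u : 𝒢.obj _) fun T => ?_⟩⟩
  have hfun : (fun f : B ⟶ T => (𝒢.baseChange S).map f (ofHom r u : 𝒢.obj _)) =
      r.homEquiv ∘ fun f : B ⟶ T => u ≫ (restrictScalarsFunctor R S).map f := by
    funext f
    exact map_ofHom r u ((restrictScalarsFunctor R S).map f)
  let : Algebra R T := Algebra.compHom T (algebraMap R S)
  have hT : IsScalarTower R S T := IsScalarTower.of_algebraMap_eq fun _ => rfl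
  refine hfun ▸ r.homEquiv.bijective.comp ⟨fun f g hfg => ?_, fun φ => ?_⟩
  · apply CommAlgCat.hom_ext
    apply Algebra.TensorProduct.ext
    · ext
    · ext x
      exact congrArg (fun φ : H ⟶ (restrictScalarsFunctor R S).obj T => φ.hom x) hfg
  · let φ' : H →ₐ[R] T := φ.hom
    refine ⟨CommAlgCat.ofHom (Algebra.TensorProduct.lift (Algebra.ofId S T) φ'
      fun _ _ => Commute.all _ _), ?_⟩
    apply CommAlgCat.hom_ext
    ext x
    have h := Algebra.TensorProduct.lift_tmul (Algebra.ofId S T) φ' (fun _ _ => Commute.all _ _) 1 x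
    rw [map_one, one_mul] at h
    exact h

end GroupFunctor

/-- A form of the infinitesimal lifting property with two additional conditions on the lift. -/
theorem Algebra.FormallySmooth.exists_lift_of_pair {A P Q H : Type u} [CommRing A] [CommRing P]
    [CommRing Q] [CommRing H] [Algebra A P] [Algebra A Q] [Algebra A H]
    [Algebra.FormallySmooth A H] (e₀ e₁ : P →ₐ[A] Q) {I : Ideal P} (hI : IsNilpotent I)
    (g h : H →ₐ[A] Q) (c : H →ₐ[A] P)
    (hz : ∀ x, ∃ z, e₀ z = g x ∧ e₁ z = h x ∧ z - c x ∈ I) :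
    ∃ γ : H →ₐ[A] P, e₀.comp γ = g ∧ e₁.comp γ = h := by
  -- All three conditions become one lifting problem, along P onto its image in Q × Q × P/I. The
  -- hypothesis `hz` says that the prescribed map lands in this image, and the kernel is nilpotent
  -- because it lies in I.
  let Ψ : P →ₐ[A] Q × Q × (P ⧸ I) := e₀.prod (e₁.prod (Ideal.Quotient.mkₐ A I))
  let φ : H →ₐ[A] Q × Q × (P ⧸ I) := g.prod (h.prod ((Ideal.Quotient.mkₐ A I).comp c))
  have hφ : ∀ x, φ x ∈ Ψ.range := fun x => by
    obtain ⟨z, hz0, hz1, hz⟩ := hz x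
    exact ⟨z, Prod.ext hz0 (Prod.ext hz1 (Ideal.Quotient.eq.2 hz))⟩
  have hker : IsNilpotent (RingHom.ker (Ψ.rangeRestrict : P →+* Ψ.range)) := by
    obtain ⟨M, hM⟩ := hI
    refine ⟨M, le_bot_iff.1 ((Ideal.pow_right_mono (fun z hz => ?_) M).trans hM.le)⟩
    have h1 : Ψ z = 0 := congrArg Subtype.val hz
    exact Ideal.Quotient.eq_zero_iff_mem.1 (congrArg (fun x => x.2.2) h1)
  let γ := Algebra.FormallySmooth.liftOfSurjective (φ.codRestrict Ψ.range hφ) Ψ.rangeRestrict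
    Ψ.rangeRestrict_surjective hker
  have hγ : ∀ x, Ψ (γ x) = φ x := fun x => congrArg Subtype.val
    (Algebra.FormallySmooth.liftOfSurjective_apply (φ.codRestrict Ψ.range hφ) Ψ.rangeRestrict
      Ψ.rangeRestrict_surjective hker x)
  exact ⟨γ, AlgHom.ext fun x => congrArg Prod.fst (hγ x),
    AlgHom.ext fun x => congrArg (fun y => y.2.1) (hγ x)⟩

/-! ### The projection of `𝐀(R)` to `R` -/

namespace GreenbergRing

/-- An algebra over the residue field of `A` is an `A`-algebra. -/
@[reducible] noncomputable def residueAlgebra (A R : Type u) [CommRing A] [IsLocalRing A] [CommRing R]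
    [Algebra (IsLocalRing.ResidueField A) R] : Algebra A R :=
  Algebra.compHom R (algebraMap A (IsLocalRing.ResidueField A))

section

attribute [local instance] wittAlgebra residueAlgebra

variable (p m : ℕ) [Fact p.Prime] (A : Type u) [CommRing A] [IsLocalRing A]
  [Algebra (TruncatedWittVector p (m + 1) (IsLocalRing.ResidueField A)) A] [IsWittAlgebra p m A]
  (R : Type u) [CommRing R] [Algebra (IsLocalRing.ResidueField A) R]

/-- The ring homomorphism `A ⊗ W_m(R) → R`, `a ⊗ w ↦ a w₀`. -/
noncomputable def preProj : Pre p m A R →+* R :=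
  letI : Algebra (TruncatedWittVector p (m + 1) (IsLocalRing.ResidueField A)) R :=
    ((algebraMap _ R).comp
      (TruncatedWittVector.constantCoeff p m (IsLocalRing.ResidueField A))).toAlgebra
  (Algebra.TensorProduct.productMap
    (A := A) (B := TruncatedWittVector p (m + 1) R) (S := R)
    { (algebraMap (IsLocalRing.ResidueField A) R).comp (IsLocalRing.residue A) with
      commutes' := fun c => by
        change algebraMap _ R (IsLocalRing.residue A (algebraMap _ A c)) =
          algebraMap _ R (TruncatedWittVector.constantCoeff p m _ c)
        rw [IsWittAlgebra.residue_algebraMap, TruncatedWittVector.constantCoeff_apply] }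
    { TruncatedWittVector.constantCoeff p m R with
      commutes' := fun c => by
        change TruncatedWittVector.constantCoeff p m R (TruncatedWittVector.map p (m + 1) _ c) =
          algebraMap _ R (TruncatedWittVector.constantCoeff p m _ c)
        rw [TruncatedWittVector.constantCoeff_apply, TruncatedWittVector.constantCoeff_apply,
          TruncatedWittVector.coeff_map] }).toRingHom

theorem preProj_tmul (a : A) (w : TruncatedWittVector p (m + 1) R) :
    preProj p m A R (a ⊗ₜ w) =
      algebraMap (IsLocalRing.ResidueField A) R (IsLocalRing.residue A a) * w.coeff 0 := by
  rw [← TruncatedWittVector.constantCoeff_apply]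
  rfl

theorem relations_le_ker_preProj : relations p m A R ≤ RingHom.ker (preProj p m A R) := by
  refine Ideal.span_le.2 ?_
  rintro _ ⟨n, a, w, ha, hw, rfl⟩
  change preProj p m A R _ = 0
  rw [preProj_tmul]
  rcases Nat.eq_zero_or_pos n with rfl | hn
  · rw [pow_zero, one_mul] at ha
    rw [ha, map_zero, map_zero, zero_mul]
  · rw [hw 0 hn, mul_zero]

/-- The homomorphism `𝐀(R) → R`. -/
noncomputable def proj : Points p m A R →ₐ[A] R :=
  { Ideal.Quotient.lift (relations p m A R) (preProj p m A R)
      (fun _ hz => relations_le_ker_preProj p m A R hz) with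
    commutes' := fun a => by
      change preProj p m A R (a ⊗ₜ 1) = algebraMap _ R (IsLocalRing.residue A a)
      rw [preProj_tmul, ← TruncatedWittVector.constantCoeff_apply, map_one, mul_one] }

/-- The homomorphism `W_m(R) → 𝐀(R)`. -/
noncomputable def ofWitt : TruncatedWittVector p (m + 1) R →+* Points p m A R :=
  (Ideal.Quotient.mk (relations p m A R)).comp
    (Algebra.TensorProduct.includeRight : TruncatedWittVector p (m + 1) R →ₐ[
      TruncatedWittVector p (m + 1) (IsLocalRing.ResidueField A)] Pre p m A R).toRingHom

omit [IsWittAlgebra p m A] in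
theorem mk_tmul (a : A) (w : TruncatedWittVector p (m + 1) R) :
    Ideal.Quotient.mk (relations p m A R) (a ⊗ₜ w) =
      algebraMap A (Points p m A R) a * ofWitt p m A R w := by
  change _ = Ideal.Quotient.mk (relations p m A R) (a ⊗ₜ 1 * 1 ⊗ₜ w)
  rw [Algebra.TensorProduct.tmul_mul_tmul, mul_one, one_mul]

theorem proj_ofWitt (w : TruncatedWittVector p (m + 1) R) :
    proj p m A R (ofWitt p m A R w) = w.coeff 0 := by
  change preProj p m A R (1 ⊗ₜ w) = _
  rw [preProj_tmul, map_one, map_one, one_mul]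

theorem proj_surjective : Function.Surjective (proj p m A R) := fun x =>
  ⟨ofWitt p m A R (TruncatedWittVector.mk p fun _ => x), by
    rw [proj_ofWitt, TruncatedWittVector.coeff_mk]⟩

variable {R} in
omit [IsWittAlgebra p m A] in
theorem pointsMap_ofWitt {S : Type u} [CommRing S] [Algebra (IsLocalRing.ResidueField A) S]
    (f : R →ₐ[IsLocalRing.ResidueField A] S) (w : TruncatedWittVector p (m + 1) R) :
    pointsMap p m f (ofWitt p m A R w) =
      ofWitt p m A S (TruncatedWittVector.map p (m + 1) (f : R →+* S) w) := rfl

variable {R} in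
theorem proj_pointsMap {S : Type u} [CommRing S] [Algebra (IsLocalRing.ResidueField A) S]
    (f : R →ₐ[IsLocalRing.ResidueField A] S) (z : Points p m A R) :
    proj p m A S (pointsMap p m f z) = f (proj p m A R z) := by
  obtain ⟨z, rfl⟩ := Ideal.Quotient.mk_surjective z
  induction z using TensorProduct.induction_on with
  | zero => simp only [map_zero]
  | add x y hx hy => simp only [map_add, hx, hy]
  | tmul a w =>
    rw [mk_tmul, map_mul, map_mul, map_mul, map_mul, AlgHom.commutes, AlgHom.commutes,
      AlgHom.commutes, pointsMap_ofWitt, proj_ofWitt, proj_ofWitt, TruncatedWittVector.coeff_map]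
    congr 1
    exact (f.commutes (IsLocalRing.residue A a)).symm

/-- The kernel of `𝐀(R) → R` is generated by the maximal ideal of `A` and `V W_m(R)`. -/
theorem ker_proj_le {J : Ideal (Points p m A R)}
    (h1 : ∀ a ∈ IsLocalRing.maximalIdeal A, algebraMap A (Points p m A R) a ∈ J)
    (h2 : ∀ w : TruncatedWittVector p (m + 1) R, w.coeff 0 = 0 → ofWitt p m A R w ∈ J) :
    RingHom.ker (proj p m A R) ≤ J := by
  let J₁ := (IsLocalRing.maximalIdeal A).map (algebraMap A (Points p m A R))
  have hJ₁ : J₁ ≤ J := Ideal.map_le_iff_le_comap.2 h1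
  have hJ₁' : J₁ ≤ RingHom.ker (proj p m A R) := Ideal.map_le_iff_le_comap.2 fun a ha => by
    change proj p m A R _ = 0
    rw [AlgHom.commutes]
    change algebraMap _ R (IsLocalRing.residue A a) = 0
    rw [(IsLocalRing.residue_eq_zero_iff a).2 ha, map_zero]
  -- Every `a` is congruent, modulo the maximal ideal, to the image of a Witt vector over k with
  -- first component `ā`; so modulo `J₁` each element comes from W_m(R).
  have key : ∀ z : Points p m A R, ∃ w, z - ofWitt p m A R w ∈ J₁ := by
    intro z
    obtain ⟨z, rfl⟩ := Ideal.Quotient.mk_surjective z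
    induction z using TensorProduct.induction_on with
    | zero => exact ⟨0, by simp⟩
    | add x y hx hy =>
      obtain ⟨v, hv⟩ := hx
      obtain ⟨w, hw⟩ := hy
      exact ⟨v + w, by rw [map_add, map_add, add_sub_add_comm]; exact add_mem hv hw⟩
    | tmul a w =>
      let c : TruncatedWittVector p (m + 1) (IsLocalRing.ResidueField A) :=
        TruncatedWittVector.mk p fun _ => IsLocalRing.residue A a
      refine ⟨c • w, ?_⟩
      have h : ofWitt p m A R (c • w) = Ideal.Quotient.mk _ ((algebraMap _ A c) ⊗ₜ w) := by
        change Ideal.Quotient.mk _ (1 ⊗ₜ (c • w)) = _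
        rw [← TensorProduct.smul_tmul, Algebra.smul_def, mul_one]
      rw [h, ← map_sub, ← TensorProduct.sub_tmul, mk_tmul]
      refine Ideal.mul_mem_right _ _ (Ideal.mem_map_of_mem _ ?_)
      rw [← IsLocalRing.residue_eq_zero_iff, map_sub, IsWittAlgebra.residue_algebraMap,
        TruncatedWittVector.coeff_mk, sub_self]
  intro z hz
  obtain ⟨w, hw⟩ := key z
  have hw0 : w.coeff 0 = 0 := by
    have := hJ₁' hw
    rwa [RingHom.mem_ker, map_sub, hz, zero_sub, neg_eq_zero, proj_ofWitt] at this
  have := add_mem (hJ₁ hw) (h2 w hw0)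
  rwa [sub_add_cancel] at this

/-- The kernel lies in the sum of two nilpotent ideals, generated by the maximal ideal of A and by
`I` = V W_m(R). From I² ⊆ pI follows I ^ (m + 2) ⊆ p ^ (m + 1) I, which becomes zero in 𝐀(R); for m
= 0 the ideal `I` itself is zero. -/
theorem isNilpotent_ker_proj [IsArtinianRing A] (hp : (p : A) ^ (m + 1) = 0 ∨ m = 0) :
    IsNilpotent (RingHom.ker (proj p m A R)) := by
  let I := RingHom.ker (TruncatedWittVector.constantCoeff p m R)
  let J₁ := (IsLocalRing.maximalIdeal A).map (algebraMap A (Points p m A R))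
  let J₂ := I.map (ofWitt p m A R)
  have hJ₁ : IsNilpotent J₁ := by
    obtain ⟨M, hM⟩ := IsWittAlgebra.isNilpotent_maximalIdeal A
    exact ⟨M, by rw [← Ideal.map_pow, hM, Ideal.zero_eq_bot, Ideal.map_bot]; rfl⟩
  have hJ₂ : IsNilpotent J₂ := by
    rcases hp with hp | rfl
    · have h2 : I * I ≤ Ideal.span {(p : TruncatedWittVector p (m + 1) R)} * I := by
        refine Ideal.mul_le.2 fun x hx y hy => ?_
        rw [RingHom.mem_ker, TruncatedWittVector.constantCoeff_apply] at hx hy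
        obtain ⟨z, hz, h⟩ := TruncatedWittVector.exists_natCast_mul_of_coeff_zero hx hy
        rw [h]
        refine Ideal.mul_mem_mul (Ideal.mem_span_singleton_self _) ?_
        rwa [RingHom.mem_ker, TruncatedWittVector.constantCoeff_apply]
      have hI : ∀ j, I ^ (j + 1) ≤ Ideal.span {(p : TruncatedWittVector p (m + 1) R) ^ j} * I := by
        intro j
        induction j with
        | zero => simp
        | succ j ih =>
          rw [pow_succ I (j + 1), pow_succ (p : TruncatedWittVector p (m + 1) R) j,
            ← Ideal.span_singleton_mul_span_singleton, mul_assoc]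
          refine (Ideal.mul_mono_left ih).trans ?_
          rw [mul_assoc]
          exact Ideal.mul_mono_right h2
      refine ⟨m + 2, le_bot_iff.1 ?_⟩
      rw [← Ideal.map_pow]
      refine (Ideal.map_mono ((hI (m + 1)).trans Ideal.mul_le_left)).trans ?_
      rw [Ideal.map_span, Set.image_singleton, map_pow, map_natCast,
        ← map_natCast (algebraMap A (Points p m A R)), ← map_pow, hp, map_zero]
      simp
    · refine ⟨1, ?_⟩
      have : I = ⊥ := le_bot_iff.1 fun x hx => by
        rw [RingHom.mem_ker, TruncatedWittVector.constantCoeff_apply] at hx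
        refine (Ideal.mem_bot).2 (TruncatedWittVector.ext fun i => ?_)
        obtain rfl : i = 0 := Fin.ext (by omega)
        rw [hx, TruncatedWittVector.coeff_zero]
      refine (pow_one J₂).trans ?_
      change I.map _ = ⊥
      rw [this, Ideal.map_bot]
  obtain ⟨M, hM⟩ := Commute.isNilpotent_add (Commute.all J₁ J₂) hJ₁ hJ₂
  refine ⟨M, le_bot_iff.1 ((Ideal.pow_right_mono ?_ M).trans hM.le)⟩
  exact ker_proj_le p m A R
    (fun a ha => Ideal.mem_sup_left (Ideal.mem_map_of_mem _ ha))
    fun w hw => Ideal.mem_sup_right (Ideal.mem_map_of_mem _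
      (by rwa [RingHom.mem_ker, TruncatedWittVector.constantCoeff_apply]))

/-! ### Paths in the fibres of the projection -/

/-- The evaluation of polynomials at an element of `R`, as a homomorphism of `k`-algebras. -/
noncomputable def evalHom (a : R) :
    Polynomial R →ₐ[IsLocalRing.ResidueField A] R :=
  (Polynomial.aeval a).restrictScalars (IsLocalRing.ResidueField A)

theorem evalHom_apply (a : R) (f : Polynomial R) : evalHom A R a f = f.eval a :=
  congrFun (Polynomial.coe_aeval_eq_eval a) f

variable {R} in
/-- Two elements of `𝐀(R)` with the same image in `R` are joined by an element of `𝐀(R[X])` whose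
image in `R[X]` is constant. -/
theorem exists_path_of_proj_eq (α β : Points p m A R) (h : proj p m A R α = proj p m A R β) :
    ∃ z : Points p m A (Polynomial R), pointsMap p m (evalHom A R 0) z = α ∧
      pointsMap p m (evalHom A R 1) z = β ∧
      proj p m A (Polynomial R) z = Polynomial.C (proj p m A R α) := by
  let C : R →ₐ[IsLocalRing.ResidueField A] Polynomial R := Polynomial.CAlgHom
  have hC : ∀ (a : R) (z : Points p m A R),
      pointsMap p m (evalHom A R a) (pointsMap p m C z) = z := fun a z => by
    rw [← pointsMap_comp]
    have : (evalHom A R a).comp C = AlgHom.id _ R := by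
      ext x
      change evalHom A R a (Polynomial.C x) = x
      rw [evalHom_apply, Polynomial.eval_C]
    rw [this, pointsMap_id]
  -- The endpoints of paths that start at 0 and lie in the kernel of the projection. They form an
  -- ideal, as paths can be added and multiplied by constants, so only the generators of the kernel
  -- of 𝐀(R) → R need to be reached.
  let J : Ideal (Points p m A R) :=
    { carrier := {δ | ∃ z : Points p m A (Polynomial R), pointsMap p m (evalHom A R 0) z = 0 ∧
        pointsMap p m (evalHom A R 1) z = δ ∧ proj p m A (Polynomial R) z = 0}
      add_mem' := by
        rintro _ _ ⟨y, hy0, rfl, hy⟩ ⟨z, hz0, rfl, hz⟩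
        exact ⟨y + z, by rw [map_add, hy0, hz0, add_zero], map_add _ _ _,
          by rw [map_add, hy, hz, add_zero]⟩
      zero_mem' := ⟨0, map_zero _, map_zero _, map_zero _⟩
      smul_mem' := by
        rintro c _ ⟨z, hz0, rfl, hz⟩
        exact ⟨pointsMap p m C c * z, by rw [map_mul, hz0, mul_zero],
          by rw [map_mul, hC, smul_eq_mul], by rw [map_mul, hz, mul_zero]⟩ }
  have hJ : RingHom.ker (proj p m A R) ≤ J := by
    refine ker_proj_le p m A R (fun a ha => ?_) fun w hw => ?_
    -- An element `a` of the maximal ideal is reached by the path `a · [X]`, with [X] the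
    -- Teichmüller representative.
    · let t : TruncatedWittVector p (m + 1) (Polynomial R) :=
        WittVector.truncate (m + 1) (WittVector.teichmuller p Polynomial.X)
      have ht : ∀ b : R, TruncatedWittVector.map p (m + 1) (evalHom A R b : _ →+* R) t =
          WittVector.truncate (m + 1) (WittVector.teichmuller p b) := fun b => by
        rw [TruncatedWittVector.map_truncate, WittVector.map_teichmuller]
        congr 2
        exact (evalHom_apply A R b _).trans Polynomial.eval_X
      refine ⟨algebraMap A _ a * ofWitt p m A _ t, ?_, ?_, ?_⟩
      · rw [map_mul, pointsMap_ofWitt, ht, WittVector.teichmuller_zero, map_zero, map_zero,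
          mul_zero]
      · rw [map_mul, pointsMap_ofWitt, ht, map_one, map_one, map_one, mul_one, AlgHom.commutes]
      · rw [map_mul, AlgHom.commutes]
        change algebraMap (IsLocalRing.ResidueField A) _ (IsLocalRing.residue A a) * _ = 0
        rw [(IsLocalRing.residue_eq_zero_iff a).2 ha, map_zero, zero_mul]
    -- An element of V W_m(R) is reached by multiplying every component by X.
    · let t : TruncatedWittVector p (m + 1) (Polynomial R) :=
        TruncatedWittVector.mk p fun i => Polynomial.C (w.coeff i) * Polynomial.X
      have ht : ∀ b : R, TruncatedWittVector.map p (m + 1) (evalHom A R b : _ →+* R) t =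
          TruncatedWittVector.mk p fun i => w.coeff i * b := fun b => by
        ext i
        rw [TruncatedWittVector.coeff_map, TruncatedWittVector.coeff_mk,
          TruncatedWittVector.coeff_mk]
        refine (evalHom_apply A R b _).trans ?_
        rw [Polynomial.eval_mul, Polynomial.eval_C, Polynomial.eval_X]
      refine ⟨ofWitt p m A _ t, ?_, ?_, ?_⟩
      · rw [pointsMap_ofWitt, ht]
        have h0 : TruncatedWittVector.mk p (fun i => w.coeff i * 0) = 0 := by
          ext i
          rw [TruncatedWittVector.coeff_mk, mul_zero, TruncatedWittVector.coeff_zero]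
        rw [h0, map_zero]
      · rw [pointsMap_ofWitt, ht]
        simp only [mul_one]
        rw [TruncatedWittVector.mk_coeff]
      · rw [proj_ofWitt, TruncatedWittVector.coeff_mk, hw, map_zero, zero_mul]
  obtain ⟨z, hz0, hz1, hz⟩ : β - α ∈ J := hJ (by rw [RingHom.mem_ker, map_sub, h, sub_self])
  -- The path from 0 to `β - α` is translated by the constant path at `α`.
  refine ⟨pointsMap p m C α + z, ?_, ?_, ?_⟩
  · rw [map_add, hC, hz0, add_zero]
  · rw [map_add, hC, hz1, add_sub_cancel]
  · rw [map_add, hz, add_zero, proj_pointsMap]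
    rfl

variable {R} in
/-- Two points of a smooth scheme with values in `𝐀(R)` and the same image in `R` are joined by a
point with values in `𝐀(R[X])`. -/
theorem exists_path [IsArtinianRing A] (hp : (p : A) ^ (m + 1) = 0 ∨ m = 0) {H : Type u}
    [CommRing H] [Algebra A H] [Algebra.FormallySmooth A H] (g h : H →ₐ[A] Points p m A R)
    (hgh : ∀ x, proj p m A R (g x) = proj p m A R (h x)) :
    ∃ γ : H →ₐ[A] Points p m A (Polynomial R),
      (pointsMap p m (evalHom A R 0)).comp γ = g ∧ (pointsMap p m (evalHom A R 1)).comp γ = h := by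
  let C : R →ₐ[IsLocalRing.ResidueField A] Polynomial R := Polynomial.CAlgHom
  -- The constant path at `g` is the approximate solution: the required path agrees with it modulo
  -- the nilpotent kernel of 𝐀(R[X]) → R[X].
  refine Algebra.FormallySmooth.exists_lift_of_pair _ _
    (isNilpotent_ker_proj p m A (Polynomial R) hp) g h ((pointsMap p m C).comp g) fun x => ?_
  obtain ⟨z, hz0, hz1, hz⟩ := exists_path_of_proj_eq p m A (g x) (h x) (hgh x)
  refine ⟨z, hz0, hz1, ?_⟩
  rw [RingHom.mem_ker, map_sub, hz, sub_eq_zero]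
  exact (proj_pointsMap p m A C (g x)).symm

end

end GreenbergRing

/-! ### Identity components over fields -/

namespace GroupFunctor

section

variable {K : Type u} [Field K]

/-- The point of `Spec T` given by a homomorphism `T → K`. -/
noncomputable def kernelPoint {T : CommAlgCat.{u} K} (t : T ⟶ CommAlgCat.of K K) : PrimeSpectrum T :=
  PrimeSpectrum.comap t.hom.toRingHom ⊥

theorem kernelPoint_comp {T T' : CommAlgCat.{u} K} (f : T ⟶ T') (t : T' ⟶ CommAlgCat.of K K) :
    kernelPoint (f ≫ t) = PrimeSpectrum.comap f.hom.toRingHom (kernelPoint t) := rfl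

theorem point_eq_kernelPoint {𝒳 : GroupFunctor K} {B : CommAlgCat.{u} K}
    (r : (𝒳 ⋙ forget GrpCat).CorepresentableBy B) (x : 𝒳.obj (CommAlgCat.of K K)) :
    point r x = kernelPoint (toHom r x) := rfl

/-- Two values of a `T`-valued point at points in the same connected component of `Spec T` lie
in the same connected component. -/
theorem point_map_mem_connectedComponent {𝒳 : GroupFunctor K} {B : CommAlgCat.{u} K}
    (r : (𝒳 ⋙ forget GrpCat).CorepresentableBy B) {T : CommAlgCat.{u} K} (y : 𝒳.obj T)
    {t₀ t₁ : T ⟶ CommAlgCat.of K K}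
    (h : kernelPoint t₀ ∈ connectedComponent (kernelPoint t₁)) :
    point r (𝒳.map t₀ y) ∈ connectedComponent (point r (𝒳.map t₁ y)) := by
  rw [point_eq_kernelPoint, point_eq_kernelPoint, toHom_map, toHom_map, kernelPoint_comp,
    kernelPoint_comp]
  exact (PrimeSpectrum.continuous_comap _).image_connectedComponent_subset _
    (Set.mem_image_of_mem _ h)

/-- The evaluation of polynomials, as a homomorphism of `K`-algebras. -/
noncomputable def polynomialEval (a : K) :
    CommAlgCat.of K (Polynomial K) ⟶ CommAlgCat.of K K :=
  CommAlgCat.ofHom (Polynomial.aeval a)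

/-- If `η : 𝒳 ⟶ 𝒴` is surjective and two `K`-points with the same image are joined by an affine
line, then the identity component of `𝒳` is the inverse image of that of `𝒴`. -/
theorem mem_identityComponentPoints_iff_of_surjective {𝒳 𝒴 : GroupFunctor K} (η : 𝒳 ⟶ 𝒴)
    {B C : CommAlgCat.{u} K} (r : (𝒳 ⋙ forget GrpCat).CorepresentableBy B)
    (q : (𝒴 ⋙ forget GrpCat).CorepresentableBy C)
    (hη : ∀ T, Function.Surjective (η.app T))
    (hpath : ∀ g h : 𝒳.obj (CommAlgCat.of K K), η.app _ g = η.app _ h →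
      ∃ γ : 𝒳.obj (CommAlgCat.of K (Polynomial K)),
        𝒳.map (polynomialEval 0) γ = g ∧ 𝒳.map (polynomialEval 1) γ = h)
    (g : 𝒳.obj (CommAlgCat.of K K)) :
    g ∈ identityComponentPoints 𝒳 ↔ η.app _ g ∈ identityComponentPoints 𝒴 := by
  have hnat : ∀ {T T' : CommAlgCat.{u} K} (t : T ⟶ T') (y : 𝒳.obj T),
      η.app T' (𝒳.map t y) = 𝒴.map t (η.app T y) := fun t y =>
    ConcreteCategory.congr_hom (η.naturality t) y
  constructor
  · rintro ⟨B, r, h⟩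
    refine ⟨C, q, ?_⟩
    -- The image under `η` of the universal point of 𝒳 is the morphism of schemes given by `η`; it
    -- takes `g` and 1 to `η g` and 1.
    have h1 := point_map_mem_connectedComponent q (η.app B (ofHom r (𝟙 B)))
      (t₀ := toHom r g) (t₁ := toHom r 1) h
    rw [← hnat, ← hnat, map_ofHom, map_ofHom, Category.id_comp, Category.id_comp, ofHom_toHom,
      ofHom_toHom, map_one] at h1
    exact h1
  · rintro ⟨C, q, h⟩
    refine ⟨B, r, ?_⟩
    -- A lift of the universal point of 𝒴 is a section of `η`, not necessarily a homomorphism.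
    obtain ⟨y, hy⟩ := hη C (ofHom q (𝟙 C))
    have hval : ∀ x : 𝒴.obj (CommAlgCat.of K K), η.app _ (𝒳.map (toHom q x) y) = x := fun x => by
      rw [hnat, hy, map_ofHom, Category.id_comp, ofHom_toHom]
    have hjoin : ∀ x x' : 𝒳.obj (CommAlgCat.of K K), η.app _ x = η.app _ x' →
        connectedComponent (point r x) = connectedComponent (point r x') := by
      intro x x' hx
      obtain ⟨γ, rfl, rfl⟩ := hpath x x' hx
      refine (connectedComponent_eq (point_map_mem_connectedComponent r γ ?_)).symm
      have : PreconnectedSpace (PrimeSpectrum (CommAlgCat.of K (Polynomial K))) :=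
        inferInstanceAs (PreconnectedSpace (PrimeSpectrum (Polynomial K)))
      rw [PreconnectedSpace.connectedComponent_eq_univ]
      trivial
    -- The values of the section over `η g` and over 1 share a component, and each is joined by a
    -- path to `g`, respectively to 1.
    have h1 := connectedComponent_eq (point_map_mem_connectedComponent r y
      (t₀ := toHom q (η.app _ g)) (t₁ := toHom q 1) h)
    rw [hjoin _ g (hval _), hjoin _ 1 ((hval _).trans (map_one _).symm)] at h1
    rw [h1]
    exact mem_connectedComponent

end

/-! ### Transport of identity components along isomorphisms of fields. -/

section

variable {A : Type u} [CommRing A] {L L' : Type u} [Field L] [Field L'] [Algebra A L] [Algebra A L']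

/-- A homomorphism of fields over `A`, as a morphism of the underlying `A`-algebras. -/
noncomputable def fieldHom (e : L →ₐ[A] L') :
    (restrictScalarsFunctor A L).obj (CommAlgCat.of L L) ⟶
      (restrictScalarsFunctor A L').obj (CommAlgCat.of L' L') :=
  @CommAlgCat.ofHom A _ L L' _ (Algebra.compHom L (algebraMap A L)) _
    (Algebra.compHom L' (algebraMap A L'))
    (@AlgHom.mk A L L' _ _ _ (Algebra.compHom L (algebraMap A L))
      (Algebra.compHom L' (algebraMap A L')) (e : L →+* L') e.commutes)

/-- Regarded as an L'-algebra through `e⁻¹`, the algebra B has the same spectrum and still carries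
the universal point of 𝒢_L. This is a point of 𝒢_{L'} over it, whose values are the transported
elements, so continuity of the resulting map of spectra applies. -/
theorem map_fieldHom_mem_identityComponentPoints {𝒢 : GroupFunctor A} {H : CommAlgCat.{u} A}
    (hH : (𝒢 ⋙ forget GrpCat).CorepresentableBy H) (e : L ≃ₐ[A] L')
    {x : (𝒢.baseChange L).obj (CommAlgCat.of L L)}
    (hx : x ∈ identityComponentPoints (𝒢.baseChange L)) :
    (𝒢.map (fieldHom (e : L →ₐ[A] L')) x : (𝒢.baseChange L').obj (CommAlgCat.of L' L')) ∈
      identityComponentPoints (𝒢.baseChange L') := by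
  obtain ⟨B, r, h⟩ := hx
  obtain ⟨B', ⟨r'⟩⟩ := exists_corepresentableBy_baseChange hH L'
  refine ⟨B', r', ?_⟩
  let φ : L' →+* B := (algebraMap L B).comp (e.symm : L' →+* L)
  let T : CommAlgCat.{u} L' := @CommAlgCat.of L' _ B _ φ.toAlgebra
  let j : (restrictScalarsFunctor A L).obj B ⟶ (restrictScalarsFunctor A L').obj T :=
    @CommAlgCat.ofHom A _ B B _ (Algebra.compHom B (algebraMap A L)) _
      (@Algebra.compHom L' A B _ _ _ φ.toAlgebra (algebraMap A L'))
      (@AlgHom.mk A B B _ _ _ (Algebra.compHom B (algebraMap A L))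
        (@Algebra.compHom L' A B _ _ _ φ.toAlgebra (algebraMap A L')) (RingHom.id B) fun a => by
          change algebraMap L B (algebraMap A L a) = algebraMap L B (e.symm (algebraMap A L' a))
          rw [AlgEquiv.commutes])
  let t : (B ⟶ CommAlgCat.of L L) → (T ⟶ CommAlgCat.of L' L') := fun f =>
    @CommAlgCat.ofHom L' _ B L' _ φ.toAlgebra _ _
      (@AlgHom.mk L' B L' _ _ _ φ.toAlgebra _ ((e : L →+* L').comp f.hom.toRingHom) fun l => by
        change e (f.hom (algebraMap L B (e.symm l))) = l
        rw [f.hom.commutes]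
        exact e.apply_symm_apply l)
  have ht : ∀ f, kernelPoint (t f) = kernelPoint f := by
    intro f
    ext b
    change e (f.hom b) = 0 ↔ f.hom b = 0
    exact EmbeddingLike.map_eq_zero_iff
  have hval : ∀ x : (𝒢.baseChange L).obj (CommAlgCat.of L L),
      (𝒢.baseChange L').map (t (toHom r x)) (𝒢.map j (ofHom r (𝟙 B) : (𝒢.baseChange L).obj B)) =
        (𝒢.map (fieldHom (e : L →ₐ[A] L')) x : (𝒢.baseChange L').obj (CommAlgCat.of L' L')) := by
    intro x
    have h1 : (𝒢.baseChange L).map (toHom r x) (ofHom r (𝟙 B)) = x := by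
      rw [map_ofHom, Category.id_comp, ofHom_toHom]
    conv_rhs => rw [← h1]
    have h2 : j ≫ (restrictScalarsFunctor A L').map (t (toHom r x)) =
        (restrictScalarsFunctor A L).map (toHom r x) ≫ fieldHom (e : L →ₐ[A] L') := rfl
    have h3 := congrArg (fun f => 𝒢.map f (ofHom r (𝟙 B) : (𝒢.baseChange L).obj B)) h2
    simp only [Functor.map_comp] at h3
    exact h3
  have h4 := point_map_mem_connectedComponent r'
    (𝒢.map j (ofHom r (𝟙 B) : (𝒢.baseChange L).obj B) : (𝒢.baseChange L').obj T)
    (t₀ := t (toHom r x)) (t₁ := t (toHom r 1)) (by rw [ht, ht]; exact h)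
  rw [hval, hval] at h4
  have h5 : 𝒢.map (fieldHom (e : L →ₐ[A] L')) 1 = 1 := map_one _
  exact h5 ▸ h4

theorem map_fieldHom_mem_identityComponentPoints_iff {𝒢 : GroupFunctor A} {H : CommAlgCat.{u} A}
    (hH : (𝒢 ⋙ forget GrpCat).CorepresentableBy H) (e : L ≃ₐ[A] L')
    (x : (𝒢.baseChange L).obj (CommAlgCat.of L L)) :
    (𝒢.map (fieldHom (e : L →ₐ[A] L')) x : (𝒢.baseChange L').obj (CommAlgCat.of L' L')) ∈
      identityComponentPoints (𝒢.baseChange L') ↔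
        x ∈ identityComponentPoints (𝒢.baseChange L) := by
  refine ⟨fun h => ?_, map_fieldHom_mem_identityComponentPoints hH e⟩
  have h1 := map_fieldHom_mem_identityComponentPoints hH e.symm h
  have h2 : fieldHom (e : L →ₐ[A] L') ≫ fieldHom (e.symm : L' →ₐ[A] L) = 𝟙 _ := by
    apply CommAlgCat.hom_ext
    ext l
    exact e.symm_apply_apply l
  have h3 : 𝒢.map (fieldHom (e.symm : L' →ₐ[A] L)) (𝒢.map (fieldHom (e : L →ₐ[A] L')) x) = x := by
    have := congrArg (fun f => 𝒢.map f x) h2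
    simp only [Functor.map_comp] at this
    exact this.trans (ConcreteCategory.congr_hom (𝒢.map_id _) x)
  exact h3 ▸ h1

end

end GroupFunctor

theorem IsWittAlgebra.pow_eq_zero_or {p m : ℕ} {A : Type u} [CommRing A]
    (hchar : CharP A (p ^ (m + 1)) ∨ (CharP A 0 ∧ m = 0)) : (p : A) ^ (m + 1) = 0 ∨ m = 0 := by
  rcases hchar with h | h
  · have := CharP.cast_eq_zero A (p ^ (m + 1))
    push_cast at this
    exact Or.inl this
  · exact Or.inr h.2

/-! ### The identity component of the Greenberg functor -/

section

attribute [local instance] GreenbergRing.residueAlgebra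

variable (p m : ℕ) [Fact p.Prime] {A : Type u} [CommRing A] [IsLocalRing A]
  [Algebra (TruncatedWittVector p (m + 1) (IsLocalRing.ResidueField A)) A] [IsWittAlgebra p m A]
  (K : Type u) [Field K] [Algebra (IsLocalRing.ResidueField A) K]

namespace GreenbergRing

/-- The projection `𝐀(R) → R`, as a ring homomorphism. -/
noncomputable def projRingHom (R : CommAlgCat.{u} (IsLocalRing.ResidueField A)) :
    (ringFunctor p m A).obj R →+* R :=
  (proj p m A R).toRingHom

theorem projRingHom_algebraMap (R : CommAlgCat.{u} (IsLocalRing.ResidueField A)) (a : A) :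
    projRingHom p m R (algebraMap A _ a) =
      algebraMap (IsLocalRing.ResidueField A) R (IsLocalRing.residue A a) :=
  (proj p m A R).commutes a

theorem projRingHom_surjective (R : CommAlgCat.{u} (IsLocalRing.ResidueField A)) :
    Function.Surjective (projRingHom p m R) :=
  proj_surjective p m A R

theorem isNilpotent_ker_projRingHom [IsArtinianRing A] (hp : (p : A) ^ (m + 1) = 0 ∨ m = 0)
    (R : CommAlgCat.{u} (IsLocalRing.ResidueField A)) :
    IsNilpotent (RingHom.ker (projRingHom p m R)) :=
  isNilpotent_ker_proj p m A R hp

theorem projRingHom_map {R S : CommAlgCat.{u} (IsLocalRing.ResidueField A)} (f : R ⟶ S)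
    (z : (ringFunctor p m A).obj R) :
    projRingHom p m S (((ringFunctor p m A).map f).hom z) = f.hom (projRingHom p m R z) :=
  proj_pointsMap p m A f.hom z

/-- The projection `𝐀(T) → T`, for `K`-algebras `T`. -/
noncomputable def projHom (T : CommAlgCat.{u} K) :
    (ringFunctor p m A).obj ((restrictScalarsFunctor (IsLocalRing.ResidueField A) K).obj T) ⟶
      (restrictScalarsFunctor A K).obj T :=
  let T' := (restrictScalarsFunctor (IsLocalRing.ResidueField A) K).obj T
  @CommAlgCat.ofHom A _ (Points p m A T') T _ _ _ (Algebra.compHom T (algebraMap A K))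
    (@AlgHom.mk A (Points p m A T') T _ _ _ _ (Algebra.compHom T (algebraMap A K))
      (proj p m A T').toRingHom (proj p m A T').commutes)

theorem projHom_naturality {T T' : CommAlgCat.{u} K} (f : T ⟶ T') :
    (ringFunctor p m A).map ((restrictScalarsFunctor (IsLocalRing.ResidueField A) K).map f) ≫
      projHom p m K T' = projHom p m K T ≫ (restrictScalarsFunctor A K).map f := by
  apply CommAlgCat.hom_ext
  ext z
  exact proj_pointsMap p m A
    ((restrictScalarsFunctor (IsLocalRing.ResidueField A) K).map f).hom z

end GreenbergRing

/-! ### Comparison of (ℱ𝒢)_K with 𝒢_K over a field K. -/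

namespace GroupFunctor

variable (𝒢 : GroupFunctor A)

/-- The projection of the Greenberg functor of a group to its special fibre. -/
noncomputable def greenbergProj :
    (greenberg p m A 𝒢).baseChange K ⟶ 𝒢.baseChange K where
  app T := 𝒢.map (GreenbergRing.projHom p m K T)
  naturality T T' f := by
    have h := congrArg (fun g => 𝒢.map g) (GreenbergRing.projHom_naturality p m K f)
    simp only [Functor.map_comp] at h
    exact h

variable {𝒢} in
-- An instance of `mem_identityComponentPoints_iff_of_surjective`. Surjectivity on T-points is
-- infinitesimal lifting along 𝐀(T) → T, and the affine lines in the fibres come from `exists_path`.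
theorem mem_identityComponentPoints_greenberg_iff [IsArtinianRing A]
    [IsAlgClosed (IsLocalRing.ResidueField A)]
    (hchar : CharP A (p ^ (m + 1)) ∨ (CharP A 0 ∧ m = 0)) {H : CommAlgCat.{u} A}
    (hH : (𝒢 ⋙ forget GrpCat).CorepresentableBy H) [Algebra.FormallySmooth A H]
    (g : ((greenberg p m A 𝒢).baseChange K).obj (CommAlgCat.of K K)) :
    g ∈ identityComponentPoints ((greenberg p m A 𝒢).baseChange K) ↔
      (greenbergProj p m K 𝒢).app _ g ∈ identityComponentPoints (𝒢.baseChange K) := by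
  have hk : CharP (IsLocalRing.ResidueField A) p ∨ m = 0 := by
    rcases hchar with h | h
    exacts [Or.inl (IsWittAlgebra.charP_residueField p m A), Or.inr h.2]
  have hp : (p : A) ^ (m + 1) = 0 ∨ m = 0 := IsWittAlgebra.pow_eq_zero_or hchar
  obtain ⟨B₀, ⟨r₀⟩⟩ := exists_corepresentableBy_comp hH (GreenbergRing.hasCoordinates p m A
    (IsWittAlgebra.hasWittDecomposition p m A hchar) hk)
  obtain ⟨B, ⟨r⟩⟩ := exists_corepresentableBy_baseChange (𝒢 := greenberg p m A 𝒢) r₀ K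
  obtain ⟨C, ⟨q⟩⟩ := exists_corepresentableBy_baseChange hH K
  refine mem_identityComponentPoints_iff_of_surjective (greenbergProj p m K 𝒢) r q ?_ ?_ g
  · intro T x
    let T' := (restrictScalarsFunctor (IsLocalRing.ResidueField A) K).obj T
    let x' : 𝒢.obj ((restrictScalarsFunctor A K).obj T) := x
    let φ : H →ₐ[A] T' := (toHom hH x').hom
    let γ := Algebra.FormallySmooth.liftOfSurjective φ (GreenbergRing.proj p m A T')
      (GreenbergRing.proj_surjective p m A T') (GreenbergRing.isNilpotent_ker_proj p m A T' hp)
    refine ⟨(ofHom hH (CommAlgCat.ofHom γ) : 𝒢.obj ((GreenbergRing.ringFunctor p m A).obj T')), ?_⟩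
    refine (map_ofHom hH (CommAlgCat.ofHom γ) (GreenbergRing.projHom p m K T)).trans ?_
    refine Eq.trans (congrArg (ofHom hH) ?_) (ofHom_toHom hH x')
    apply CommAlgCat.hom_ext
    ext y
    exact Algebra.FormallySmooth.liftOfSurjective_apply φ (GreenbergRing.proj p m A T')
      (GreenbergRing.proj_surjective p m A T') (GreenbergRing.isNilpotent_ker_proj p m A T' hp) y
  · intro g h hgh
    let K' := (restrictScalarsFunctor (IsLocalRing.ResidueField A) K).obj (CommAlgCat.of K K)
    let g' : 𝒢.obj ((GreenbergRing.ringFunctor p m A).obj K') := g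
    let h' : 𝒢.obj ((GreenbergRing.ringFunctor p m A).obj K') := h
    have hgh' : 𝒢.map (GreenbergRing.projHom p m K _) g' =
        𝒢.map (GreenbergRing.projHom p m K _) h' := hgh
    have hgh₂ := congrArg (toHom hH) hgh'
    rw [toHom_map, toHom_map] at hgh₂
    obtain ⟨γ, hγ₀, hγ₁⟩ := GreenbergRing.exists_path p m A (R := K') hp (toHom hH g').hom
      (toHom hH h').hom fun x => congrArg
        (fun f : H ⟶ (restrictScalarsFunctor A K).obj (CommAlgCat.of K K) => f.hom x) hgh₂
    let P := (restrictScalarsFunctor (IsLocalRing.ResidueField A) K).obj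
      (CommAlgCat.of K (Polynomial K))
    -- The identity of K[X], which matches its k-algebra structure as polynomials over K with the
    -- one restricted from K.
    let i : Polynomial K' →ₐ[IsLocalRing.ResidueField A] P :=
      { RingHom.id (Polynomial K) with commutes' := fun _ => rfl }
    have hi : ∀ a : K, ((restrictScalarsFunctor (IsLocalRing.ResidueField A) K).map
        (polynomialEval a)).hom.comp i = GreenbergRing.evalHom A K' a := fun a => rfl
    let δ : H ⟶ (GreenbergRing.ringFunctor p m A).obj P :=
      CommAlgCat.ofHom ((GreenbergRing.pointsMap p m i).comp γ)
    have hδ : ∀ a : K, δ ≫ (GreenbergRing.ringFunctor p m A).map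
        ((restrictScalarsFunctor (IsLocalRing.ResidueField A) K).map (polynomialEval a)) =
          CommAlgCat.ofHom ((GreenbergRing.pointsMap p m (GreenbergRing.evalHom A K' a)).comp γ) := by
      intro a
      apply CommAlgCat.hom_ext
      ext x
      rw [← hi]
      exact (GreenbergRing.pointsMap_comp p m i _ (γ x)).symm
    have hval : ∀ (a : K) (x : 𝒢.obj ((GreenbergRing.ringFunctor p m A).obj K')),
        (GreenbergRing.pointsMap p m (GreenbergRing.evalHom A K' a)).comp γ = (toHom hH x).hom →
          ((greenberg p m A 𝒢).baseChange K).map (polynomialEval a) (ofHom hH δ : 𝒢.obj _) = x := by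
      intro a x hx
      refine (map_ofHom hH δ _).trans (Eq.trans (congrArg (ofHom hH) ?_) (ofHom_toHom hH x))
      exact (hδ a).trans (by rw [hx]; rfl)
    exact ⟨(ofHom hH δ : 𝒢.obj ((GreenbergRing.ringFunctor p m A).obj P)), hval 0 g' hγ₀,
      hval 1 h' hγ₁⟩

end GroupFunctor

end

/-! ### Points and residue fields of Spec 𝐀(R). -/

section

open GroupFunctor

variable (p m : ℕ) [Fact p.Prime] (A : Type u) [CommRing A] [IsLocalRing A]
  [Algebra (TruncatedWittVector p (m + 1) (IsLocalRing.ResidueField A)) A] [IsWittAlgebra p m A]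

namespace GreenbergRing

variable {A} (R : CommAlgCat.{u} (IsLocalRing.ResidueField A)) (s : PrimeSpectrum R)

/-- The point of `Spec 𝐀(R)` corresponding to a point of `Spec R`. -/
noncomputable def specProj : PrimeSpectrum ((ringFunctor p m A).obj R) :=
  PrimeSpectrum.comap (projRingHom p m R) s

theorem asIdeal_specProj :
    (specProj p m R s).asIdeal = s.asIdeal.comap (projRingHom p m R) := rfl

/-- Every prime ideal contains the nilpotent kernel of the surjection 𝐀(R) → R. -/
theorem specProj_surjective [IsArtinianRing A] (hp : (p : A) ^ (m + 1) = 0 ∨ m = 0) :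
    Function.Surjective (specProj p m R) := by
  intro s'
  have h := range_comap_of_surjective R (projRingHom p m R) (projRingHom_surjective p m R)
  have h1 : s' ∈ PrimeSpectrum.zeroLocus
      (RingHom.ker (projRingHom p m R) : Set ((ringFunctor p m A).obj R)) := by
    obtain ⟨M, hM⟩ := isNilpotent_ker_projRingHom p m hp R
    have h2 : RingHom.ker (projRingHom p m R) ^ M ≤ s'.asIdeal := hM.le.trans bot_le
    exact s'.2.le_of_pow_le h2
  exact h.ge h1

/-- Corresponding points of `Spec 𝐀(R)` and `Spec R` have the same residue field. -/
noncomputable def residueFieldEquiv :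
    letI := residueAlgebra A s.asIdeal.ResidueField
    (specProj p m R s).asIdeal.ResidueField ≃ₐ[A] s.asIdeal.ResidueField :=
  letI := residueAlgebra A s.asIdeal.ResidueField
  { RingEquiv.ofBijective (Ideal.ResidueField.map (specProj p m R s).asIdeal s.asIdeal
      (projRingHom p m R) (asIdeal_specProj p m R s))
      (RingHom.SurjectiveOnStalks.residueFieldMap_bijective
        (RingHom.surjectiveOnStalks_of_surjective (projRingHom_surjective p m R)) _ _
        (asIdeal_specProj p m R s)) with
    commutes' := fun a => by
      change Ideal.ResidueField.map _ _ _ _ (algebraMap A _ a) =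
        algebraMap (IsLocalRing.ResidueField A) s.asIdeal.ResidueField (IsLocalRing.residue A a)
      rw [IsScalarTower.algebraMap_apply A ((ringFunctor p m A).obj R)
        (specProj p m R s).asIdeal.ResidueField, Ideal.ResidueField.map_algebraMap,
        projRingHom_algebraMap, ← IsScalarTower.algebraMap_apply] }

/-- The two ways from 𝐀(R) to κ(s), through its own residue field or through 𝐀(κ(s)), agree. This
links the value of g as a point of 𝒢 with its value as a point of ℱ𝒢. -/
theorem toResidueField_comp_fieldHom :
    letI := residueAlgebra A s.asIdeal.ResidueField
    toResidueField ((ringFunctor p m A).obj R) (specProj p m R s) ≫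
        fieldHom (residueFieldEquiv p m R s : _ →ₐ[A] _) =
      (ringFunctor p m A).map (toResidueField R s) ≫
        projHom p m s.asIdeal.ResidueField (CommAlgCat.of _ s.asIdeal.ResidueField) := by
  let := residueAlgebra A s.asIdeal.ResidueField
  apply CommAlgCat.hom_ext
  ext z
  refine (Ideal.ResidueField.map_algebraMap (specProj p m R s).asIdeal s.asIdeal
    (projRingHom p m R) (asIdeal_specProj p m R s) z).trans ?_
  exact (projRingHom_map p m (toResidueField R s) z).symm

end GreenbergRing

end

theorem mainTheorem7 (p m : ℕ) [Fact p.Prime] (A : Type u) [CommRing A] [IsLocalRing A]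
    [IsArtinianRing A] [IsAlgClosed (IsLocalRing.ResidueField A)]
    (hchar : CharP A (p ^ (m + 1)) ∨ (CharP A 0 ∧ m = 0))
    [Algebra (TruncatedWittVector p (m + 1) (IsLocalRing.ResidueField A)) A]
    [IsWittAlgebra p m A]
    (𝒢 : GroupFunctor A) (H : CommAlgCat.{u} A)
    (hH : (𝒢 ⋙ forget GrpCat).CorepresentableBy H) [Algebra.Smooth A H] :
    greenbergSub p m A 𝒢.identityComponent = (greenberg p m A 𝒢).identityComponent := by
  have hp : (p : A) ^ (m + 1) = 0 ∨ m = 0 := IsWittAlgebra.pow_eq_zero_or hchar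
  funext R
  ext g
  let g' : 𝒢.obj ((GreenbergRing.ringFunctor p m A).obj R) := g
  -- The condition over Spec 𝐀(R) is reindexed by Spec R, after which the two conditions are
  -- compared point by point.
  refine Iff.trans (GreenbergRing.specProj_surjective p m R hp).forall (forall_congr' fun s => ?_)
  let _ : Algebra A s.asIdeal.ResidueField := GreenbergRing.residueAlgebra A s.asIdeal.ResidueField
  -- Both sides become membership in the identity component of 𝒢 over κ(s): the right side by
  -- projecting from 𝐀(κ(s)), the left by the isomorphism of residue fields.
  rw [GroupFunctor.mem_identityComponentPoints_greenberg_iff p m s.asIdeal.ResidueField hchar hH,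
    ← GroupFunctor.map_fieldHom_mem_identityComponentPoints_iff hH
      (GreenbergRing.residueFieldEquiv p m R s)]
  have h := congrArg (fun f => 𝒢.map f g') (GreenbergRing.toResidueField_comp_fieldHom p m R s)
  simp only [Functor.map_comp] at h
  exact iff_of_eq (congrArg
    (· ∈ GroupFunctor.identityComponentPoints (𝒢.baseChange s.asIdeal.ResidueField)) h)
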